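/- All C*-algebras below are separable, and morphisms are $*$-homomorphisms (algebras and morphisms need not be unital). Ideals are closed and two-sided. **Definitions.** A morphism $\varphi\colon A\to B$ is *projective* if for every C*-algebra $C$, every ideal $J\lhd C$ with quotient map $\pi\colon C\to C/J$ and every morphism $\sigma\colon B\to C/J$ there is a morphism $\psi\colon A\to C$ with $\pi\circ\psi=\sigma\circ\varphi$. It is *semiprojective* if for every C*-algebra $C$, every increasing sequence of ideals $J_1\subseteq J_2\subseteq\dots$ of $C$ and every morphism $\sigma\colon B\to C/\overline{\bigcup_k J_k}$ there are an index $k$ and a morphism $\psi\colon A\to C/J_k$ with $\pi_k\circ\psi=\sigma\circ\varphi$, where $\pi_k\colon C/J_k\to C/\overline{\bigcup_k J_k}$ is the quotient map. It is *weakly projective* (resp. *weakly semiprojective*) if in the same situation, for every $\varepsilon>0$ and every finite set $F\subset A$, there is a $\psi$ (resp. a $k$ and a $\psi$) with $\|\pi(\psi(x))-\sigma(\varphi(x))\|<\varepsilon$ (resp. $\|\pi_k(\psi(x))-\sigma(\varphi(x))\|<\varepsilon$) for all $x\in F$. A C*-algebra $A$ has one of these four properties if $\mathrm{id}_A$ has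 it. Two morphisms $A\to B$ are *homotopic*, written $\simeq$, if they are joined by a path $(\varphi_t)_{t\in[0,1]}$ of morphisms such that $t\mapsto\varphi_t(a)$ is norm continuous for each $a\in A$. A *shape system* for $A$ is a sequence $A_1\xrightarrow{\gamma_1}A_2\xrightarrow{\gamma_2}\cdots$ of C*-algebras with semiprojective connecting morphisms and with inductive limit $A$. For $k<l$ let $\gamma_{l,k}=\gamma_{l-1}\circ\dots\circ\gamma_k\colon A_k\to A_l$. Two sequences $(A_k,\gamma_k)$ and $(B_n,\theta_n)$ are *equivalent* if there are indices $k_1<n_1<k_2<n_2<\cdots$ and morphisms $\alpha_i\colon A_{k_i}\to B_{n_i}$, $\beta_i\colon B_{n_i}\to A_{k_{i+1}}$ such that $\beta_i\circ\alpha_i\simeq\gamma_{k_{i+1},k_i}$ and $\alpha_{i+1}\circ\beta_i\simeq\theta_{n_{i+1},n_i}$ for all $i$. $A$ has *trivial shape* if some shape system for $A$ is equivalent to some shape system for the zero C*-algebra. **Theorem.** Let $A$ be a separable C*-algebra. Then: 1. $A$ is projective if and only if $A$ is semiprojective and has trivial shape. 2. $A$ is weakly projective if and only if $A$ is weakly semiprojective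 and has trivial shape. -/

import Mathlib

open Filter Topology

universe u

namespace CStarShape

section Morphisms

/-- `S` is the kernel of the surjective *-homomorphism `π : C → Q`. By the first isomorphism
theorem for C*-algebras, this says that `Q` together with `π` is the quotient of `C` by the
ideal `S`. -/
structure IsQuotientBy {C Q : Type u} [NonUnitalCStarAlgebra C] [NonUnitalCStarAlgebra Q]
    (S : Set C) (π : C →⋆ₙₐ[ℂ] Q) : Prop where
  surjective : Function.Surjective π
  mem_iff : ∀ c : C, c ∈ S ↔ π c = 0

variable {A B : Type u} [NonUnitalCStarAlgebra A] [NonUnitalCStarAlgebra B]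

/-- `φ : A → B` is projective: for every separable `C`, closed ideal `J` of `C` with quotient
map `π : C → C/J`, and `σ : B → C/J`, the morphism `σ ∘ φ` lifts along `π`. -/
def ProjectiveHom (φ : A →⋆ₙₐ[ℂ] B) : Prop :=
  ∀ (C Q : Type u) [NonUnitalCStarAlgebra C] [TopologicalSpace.SeparableSpace C]
    [NonUnitalCStarAlgebra Q] (J : TwoSidedIdeal C) (π : C →⋆ₙₐ[ℂ] Q),
    IsClosed (J : Set C) → IsQuotientBy (J : Set C) π →
    ∀ σ : B →⋆ₙₐ[ℂ] Q, ∃ ψ : A →⋆ₙₐ[ℂ] C, π.comp ψ = σ.comp φ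

/-- `φ : A → B` is weakly projective: as for projectivity, but lifts are only required up to
`ε` on a given finite set `F`. -/
def WeaklyProjectiveHom (φ : A →⋆ₙₐ[ℂ] B) : Prop :=
  ∀ (C Q : Type u) [NonUnitalCStarAlgebra C] [TopologicalSpace.SeparableSpace C]
    [NonUnitalCStarAlgebra Q] (J : TwoSidedIdeal C) (π : C →⋆ₙₐ[ℂ] Q),
    IsClosed (J : Set C) → IsQuotientBy (J : Set C) π →
    ∀ (σ : B →⋆ₙₐ[ℂ] Q) (ε : ℝ) (F : Finset A), 0 < ε →
      ∃ ψ : A →⋆ₙₐ[ℂ] C, ∀ a ∈ F, ‖π (ψ a) - σ (φ a)‖ < ε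

/-- `φ : A → B` is semiprojective. Here `ρ k : C → C/J_k` and `π : C → C/J`, with `J` the
closure of `⋃ k, J k`, are the quotient maps, and `p k : C/J_k → C/J` is the induced map. -/
def SemiprojectiveHom (φ : A →⋆ₙₐ[ℂ] B) : Prop :=
  ∀ (C : Type u) [NonUnitalCStarAlgebra C] [TopologicalSpace.SeparableSpace C]
    (J : ℕ → TwoSidedIdeal C), (∀ k, IsClosed (J k : Set C)) → Monotone J →
  ∀ (D : ℕ → Type u) [∀ k, NonUnitalCStarAlgebra (D k)] (Q : Type u) [NonUnitalCStarAlgebra Q]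
    (ρ : ∀ k, C →⋆ₙₐ[ℂ] D k) (π : C →⋆ₙₐ[ℂ] Q) (p : ∀ k, D k →⋆ₙₐ[ℂ] Q),
    (∀ k, IsQuotientBy (J k : Set C) (ρ k)) →
    IsQuotientBy (closure (⋃ k, (J k : Set C))) π →
    (∀ k, (p k).comp (ρ k) = π) →
    ∀ σ : B →⋆ₙₐ[ℂ] Q, ∃ (k : ℕ) (ψ : A →⋆ₙₐ[ℂ] D k), (p k).comp ψ = σ.comp φ

/-- `φ : A → B` is weakly semiprojective: as for semiprojectivity, but lifts are only required
up to `ε` on a given finite set `F`. -/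
def WeaklySemiprojectiveHom (φ : A →⋆ₙₐ[ℂ] B) : Prop :=
  ∀ (C : Type u) [NonUnitalCStarAlgebra C] [TopologicalSpace.SeparableSpace C]
    (J : ℕ → TwoSidedIdeal C), (∀ k, IsClosed (J k : Set C)) → Monotone J →
  ∀ (D : ℕ → Type u) [∀ k, NonUnitalCStarAlgebra (D k)] (Q : Type u) [NonUnitalCStarAlgebra Q]
    (ρ : ∀ k, C →⋆ₙₐ[ℂ] D k) (π : C →⋆ₙₐ[ℂ] Q) (p : ∀ k, D k →⋆ₙₐ[ℂ] Q),
    (∀ k, IsQuotientBy (J k : Set C) (ρ k)) →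
    IsQuotientBy (closure (⋃ k, (J k : Set C))) π →
    (∀ k, (p k).comp (ρ k) = π) →
    ∀ (σ : B →⋆ₙₐ[ℂ] Q) (ε : ℝ) (F : Finset A), 0 < ε →
      ∃ (k : ℕ) (ψ : A →⋆ₙₐ[ℂ] D k), ∀ a ∈ F, ‖p k (ψ a) - σ (φ a)‖ < ε

/-- Homotopy of *-homomorphisms: a point-norm continuous path of *-homomorphisms. -/
def Homotopic (φ ψ : A →⋆ₙₐ[ℂ] B) : Prop :=
  ∃ H : unitInterval → (A →⋆ₙₐ[ℂ] B),
    (∀ a, Continuous fun t => H t a) ∧ H 0 = φ ∧ H 1 = ψ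

end Morphisms

section Algebras

variable (A : Type u) [NonUnitalCStarAlgebra A]

def IsProjective : Prop := ProjectiveHom (NonUnitalStarAlgHom.id ℂ A)

def IsWeaklyProjective : Prop := WeaklyProjectiveHom (NonUnitalStarAlgHom.id ℂ A)

def IsSemiprojective : Prop := SemiprojectiveHom (NonUnitalStarAlgHom.id ℂ A)

def IsWeaklySemiprojective : Prop := WeaklySemiprojectiveHom (NonUnitalStarAlgHom.id ℂ A)

end Algebras

/-- A sequential inductive system of separable C*-algebras. -/
structure InductiveSystem where
  obj : ℕ → Type u
  [cstar : ∀ k, NonUnitalCStarAlgebra (obj k)]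
  [separable : ∀ k, TopologicalSpace.SeparableSpace (obj k)]
  map : ∀ k, obj k →⋆ₙₐ[ℂ] obj (k + 1)

attribute [instance] InductiveSystem.cstar InductiveSystem.separable

namespace InductiveSystem

/-- The composed connecting morphism `obj k → obj l` for `k ≤ l`. -/
def trans (S : InductiveSystem.{u}) {k l : ℕ} (h : k ≤ l) : S.obj k →⋆ₙₐ[ℂ] S.obj l :=
  Nat.leRecOn (C := fun n => S.obj k →⋆ₙₐ[ℂ] S.obj n) h (fun {n} f => (S.map n).comp f)
    (NonUnitalStarAlgHom.id ℂ (S.obj k))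

/-- `A` with the morphisms `ι k : obj k → A` is the C*-algebraic inductive limit of `S`, i.e.
the completion of the algebraic direct limit, divided by its null space, for the seminorm
given by `lim_n ‖trans (k ≤ n) a‖` on the class of `a : obj k`. -/
structure IsLimit (S : InductiveSystem.{u}) (A : Type u) [NonUnitalCStarAlgebra A]
    (ι : ∀ k, S.obj k →⋆ₙₐ[ℂ] A) : Prop where
  compat : ∀ k, (ι (k + 1)).comp (S.map k) = ι k
  dense : Dense (⋃ k, Set.range (ι k))
  norm_tendsto : ∀ (k : ℕ) (a : S.obj k),
    Tendsto (fun n : ℕ => ‖S.trans (Nat.le_add_right k n) a‖) atTop (𝓝 ‖ι k a‖)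

/-- A shape system for `A`: limit `A` and semiprojective connecting morphisms. -/
def IsShapeSystem (S : InductiveSystem.{u}) (A : Type u) [NonUnitalCStarAlgebra A] : Prop :=
  (∃ ι : ∀ k, S.obj k →⋆ₙₐ[ℂ] A, S.IsLimit A ι) ∧ ∀ k, SemiprojectiveHom (S.map k)

/-- Equivalence of inductive systems: a homotopy-commutative intertwining along indices
`k 0 < n 0 < k 1 < n 1 < ⋯`. -/
def Equivalent (S T : InductiveSystem.{u}) : Prop :=
  ∃ (k n : ℕ → ℕ) (hkn : ∀ i, k i < n i) (hnk : ∀ i, n i < k (i + 1))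
    (α : ∀ i, S.obj (k i) →⋆ₙₐ[ℂ] T.obj (n i))
    (β : ∀ i, T.obj (n i) →⋆ₙₐ[ℂ] S.obj (k (i + 1))),
    (∀ i, Homotopic ((β i).comp (α i)) (S.trans ((hkn i).trans (hnk i)).le)) ∧
    ∀ i, Homotopic ((α (i + 1)).comp (β i)) (T.trans ((hnk i).trans (hkn (i + 1))).le)

end InductiveSystem

/-- Shape equivalence: some shape systems of `A` and `B` are equivalent. -/
def ShapeEquivalent (A B : Type u) [NonUnitalCStarAlgebra A] [NonUnitalCStarAlgebra B] : Prop :=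
  ∃ S T : InductiveSystem.{u}, S.IsShapeSystem A ∧ T.IsShapeSystem B ∧ S.Equivalent T

/-- The zero C*-algebra. -/
noncomputable instance instPUnit : NonUnitalCStarAlgebra PUnit.{u + 1} where
  star := id
  star_involutive _ := rfl
  star_mul _ _ := rfl
  star_add _ _ := rfl
  norm_mul_self_le _ := by simp
  star_smul _ _ := rfl

/-- Trivial shape: shape equivalence to the zero C*-algebra. -/
def HasTrivialShape (A : Type u) [NonUnitalCStarAlgebra A] : Prop :=
  ShapeEquivalent A PUnit.{u + 1}

end CStarShape

/-!
Asymptotic morphisms are treated as subalgebras `R` of `(∏ C n) × G` in which the norms of the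
first coordinate are asymptotically controlled by the norm of the second. The image of the closure
of `R` in `G` is then its quotient by the closed union of an increasing sequence of ideals, so
semiprojectivity replaces an asymptotic morphism by honest homomorphisms.

For a surjection `π : C → Q`, a quasicentral approximate unit of the kernel gives the asymptotic
morphism `f ⊗ π c ↦ (f(aₙ) c)` from the cone over `Q` to `C`. Hence a semiprojective morphism
followed by a null-homotopic one is projective. The connecting morphisms of a shape system of an
algebra of trivial shape are eventually null-homotopic, so maps into `Q` lift along them, and a
weakly semiprojective algebra maps approximately back into such a system.

Conversely, write `A` as the limit of the universal C*-algebras on selfadjoint contractions subject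
to finitely many relaxed relations of a presentation of `A`. Any two homomorphisms out of the free
algebra are homotopic along the linear path between the images of the generators. If `A` is weakly
projective, approximate splittings `A → F` of the presentation from the free algebra `F` turn the
linear path from `id` to `F → A → F` into a null-homotopy of the connecting morphisms.
-/

namespace CStarShape

open scoped CStarAlgebra ComplexStarModule ENNReal NNReal

section BoundedLifting

variable {C D : Type*} [NonUnitalCStarAlgebra C] [NonUnitalCStarAlgebra D]

lemma exists_isSelfAdjoint_preimage_norm_le (f : C →⋆ₙₐ[ℂ] D) {y : D} (hy : y ∈ Set.range f)
    (hsa : IsSelfAdjoint y) {r : ℝ} (hr : ‖y‖ ≤ r) :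
    ∃ c : C, IsSelfAdjoint c ∧ f c = y ∧ ‖c‖ ≤ r := by
  obtain ⟨c, rfl⟩ := hy
  have hr₀ : 0 ≤ r := (norm_nonneg _).trans hr
  have hre : f (ℜ c) = f c := by rw [map_realPart, hsa.coe_realPart]
  let clamp : ℝ → ℝ := fun t => max (-r) (min r t)
  have hclamp : Continuous clamp := by fun_prop
  refine ⟨cfcₙ clamp (ℜ c : C), cfcₙ_predicate _ _, ?_, norm_cfcₙ_le fun x _ => ?_⟩
  · have hclamp₀ : clamp 0 = 0 := by simp [clamp, hr₀]
    have hcfc := NonUnitalStarAlgHom.map_cfcₙ f clamp (ℜ c : C) hclamp.continuousOn hclamp₀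
      (map_continuous f) (ℜ c).2 ((ℜ c).2.map f)
    rw [hre] at hcfc
    refine hcfc.trans ?_
    conv_rhs => rw [← cfcₙ_id ℝ (f c) hsa]
    refine cfcₙ_congr fun x hx => ?_
    have hx' : ‖x‖ ≤ ‖f c‖ :=
      NonUnitalIsometricContinuousFunctionalCalculus.norm_quasispectrum_le _ hx hsa
    obtain ⟨hl, hu⟩ := abs_le.1 (hx'.trans hr)
    simp [clamp, hl, hu]
  · rw [Real.norm_eq_abs, abs_le]
    exact ⟨le_max_left _ _, max_le (by linarith) (min_le_left _ _)⟩

lemma exists_preimage_norm_le (f : C →⋆ₙₐ[ℂ] D) {y : D} (hy : y ∈ Set.range f) :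
    ∃ c : C, f c = y ∧ ‖c‖ ≤ 2 * ‖y‖ := by
  obtain ⟨c, rfl⟩ := hy
  obtain ⟨a, -, hfa, ha⟩ := exists_isSelfAdjoint_preimage_norm_le f ⟨ℜ c, map_realPart f c⟩
    (ℜ (f c)).2 (realPart.norm_le (f c))
  obtain ⟨b, -, hfb, hb⟩ := exists_isSelfAdjoint_preimage_norm_le f ⟨ℑ c, map_imaginaryPart f c⟩
    (ℑ (f c)).2 (imaginaryPart.norm_le (f c))
  refine ⟨a + Complex.I • b, ?_, ?_⟩
  · rw [map_add, map_smul, hfa, hfb, realPart_add_I_smul_imaginaryPart]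
  · refine (norm_add_le _ _).trans ?_
    rw [norm_smul, Complex.norm_I]
    linarith

lemma isClosed_range (f : C →⋆ₙₐ[ℂ] D) : IsClosed (Set.range f) := by
  let g : NormedAddGroupHom C D :=
    { toFun := f
      map_add' := map_add f
      bound' := ⟨1, fun c => by simpa using NonUnitalStarAlgHom.norm_apply_le f c⟩ }
  have hg : g.SurjectiveOnWith (AddMonoidHom.range g.toAddMonoidHom) 2 := fun y hy =>
    exists_preimage_norm_le f hy
  refine isClosed_of_closure_subset fun y hy => ?_
  obtain ⟨c, hc, -⟩ := controlled_closure_of_complete two_pos one_pos hg y hy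
  exact ⟨c, hc⟩

lemma exists_mem_ker_norm_sub_le (f : C →⋆ₙₐ[ℂ] D) (c : C) :
    ∃ d : C, f d = 0 ∧ ‖c - d‖ ≤ 2 * ‖f c‖ := by
  obtain ⟨e, he, hn⟩ := exists_preimage_norm_le f ⟨c, rfl⟩
  exact ⟨c - e, by simp [he], by simpa using hn⟩

lemma isClosed_ker (f : C →⋆ₙₐ[ℂ] D) : IsClosed (TwoSidedIdeal.ker f : Set C) := by
  have : (TwoSidedIdeal.ker f : Set C) = f ⁻¹' {0} := by
    ext x; simp [TwoSidedIdeal.mem_ker]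
  rw [this]
  exact isClosed_singleton.preimage (map_continuous f)

end BoundedLifting

lemma isQuotientBy_ker {C D : Type u} [NonUnitalCStarAlgebra C] [NonUnitalCStarAlgebra D]
    {f : C →⋆ₙₐ[ℂ] D} (hf : Function.Surjective f) :
    IsQuotientBy (TwoSidedIdeal.ker f : Set C) f :=
  ⟨hf, fun _ => TwoSidedIdeal.mem_ker f⟩

section Generated

lemma countable_subsemigroupClosure {M : Type*} [Semigroup M] {s : Set M} (hs : s.Countable) :
    (Subsemigroup.closure s : Set M).Countable := by
  have := hs.to_subtype
  have : Countable (FreeSemigroup s) := by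
    refine Function.Injective.countable (f := fun w : FreeSemigroup s => (w.head, w.tail)) ?_
    rintro ⟨a, b⟩ ⟨c, d⟩ h
    simp_all
  have hle : Subsemigroup.closure s ≤ (FreeSemigroup.lift ((↑) : s → M)).srange :=
    Subsemigroup.closure_le.2 fun x hx => ⟨FreeSemigroup.of ⟨x, hx⟩, by simp⟩
  exact (Set.countable_range (FreeSemigroup.lift ((↑) : s → M))).mono hle

variable {C : Type*} [NonUnitalCStarAlgebra C]

/-- The C*-subalgebra generated by a set. -/
def generated (s : Set C) : NonUnitalStarSubalgebra ℂ C :=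
  (NonUnitalStarAlgebra.adjoin ℂ s).topologicalClosure

instance isClosed_generated (s : Set C) : IsClosed (generated s : Set C) :=
  NonUnitalStarSubalgebra.isClosed_topologicalClosure _

lemma subset_generated (s : Set C) : s ⊆ generated s := fun _ hx =>
  NonUnitalStarSubalgebra.le_topologicalClosure _ (NonUnitalStarAlgebra.subset_adjoin ℂ s hx)

lemma generated_le {s : Set C} {S : NonUnitalStarSubalgebra ℂ C} (hS : IsClosed (S : Set C))
    (h : s ⊆ S) : generated s ≤ S :=
  NonUnitalStarSubalgebra.topologicalClosure_minimal _ (NonUnitalStarAlgebra.adjoin_le h) hS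

lemma separableSpace_generated {s : Set C} (hs : s.Countable) :
    TopologicalSpace.SeparableSpace (generated s) := by
  have hspan : (NonUnitalStarAlgebra.adjoin ℂ s : Set C) =
      Submodule.span ℂ (Subsemigroup.closure (s ∪ star s) : Set C) :=
    congrArg (fun p : Submodule ℂ C => (p : Set C)) (NonUnitalStarAlgebra.adjoin_eq_span s)
  have hstar : (star s).Countable := by
    rw [← Set.image_star]
    exact hs.image _
  have hsep : TopologicalSpace.IsSeparable (NonUnitalStarAlgebra.adjoin ℂ s : Set C) := by
    rw [hspan]
    exact (countable_subsemigroupClosure (hs.union hstar)).isSeparable.span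
  exact hsep.closure.separableSpace

end Generated

section LiftsUpTo

variable {A B : Type u} [NonUnitalCStarAlgebra A] [NonUnitalCStarAlgebra B]

/-- The lifting property of `φ` along an increasing sequence of ideals, where the norms of the
errors at elements of `S` are required to lie in `N`. Semiprojectivity is the case `S = univ`,
`N = {0}`, and weak semiprojectivity consists of the cases with `S` finite and `N = {r | r < ε}`. -/
def LiftsUpTo (φ : A →⋆ₙₐ[ℂ] B) (S : Set A) (N : Set ℝ) : Prop :=
  ∀ (C : Type u) [NonUnitalCStarAlgebra C] [TopologicalSpace.SeparableSpace C]
    (J : ℕ → TwoSidedIdeal C), (∀ k, IsClosed (J k : Set C)) → Monotone J →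
  ∀ (D : ℕ → Type u) [∀ k, NonUnitalCStarAlgebra (D k)] (Q : Type u) [NonUnitalCStarAlgebra Q]
    (ρ : ∀ k, C →⋆ₙₐ[ℂ] D k) (π : C →⋆ₙₐ[ℂ] Q) (p : ∀ k, D k →⋆ₙₐ[ℂ] Q),
    (∀ k, IsQuotientBy (J k : Set C) (ρ k)) →
    IsQuotientBy (closure (⋃ k, (J k : Set C))) π →
    (∀ k, (p k).comp (ρ k) = π) →
    ∀ σ : B →⋆ₙₐ[ℂ] Q, ∃ (k : ℕ) (ψ : A →⋆ₙₐ[ℂ] D k), ∀ a ∈ S, ‖p k (ψ a) - σ (φ a)‖ ∈ N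

lemma SemiprojectiveHom.liftsUpTo {φ : A →⋆ₙₐ[ℂ] B} (hφ : SemiprojectiveHom φ) :
    LiftsUpTo φ Set.univ {0} := by
  intro C _ _ J hJ hm D _ Q _ ρ π p hρ hπ hp σ
  obtain ⟨k, ψ, hψ⟩ := hφ C J hJ hm D Q ρ π p hρ hπ hp σ
  refine ⟨k, ψ, fun a _ => ?_⟩
  have ha : p k (ψ a) = σ (φ a) := DFunLike.congr_fun hψ a
  simp [ha]

lemma WeaklySemiprojectiveHom.liftsUpTo {φ : A →⋆ₙₐ[ℂ] B} (hφ : WeaklySemiprojectiveHom φ)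
    (F : Finset A) {ε : ℝ} (hε : 0 < ε) : LiftsUpTo φ F (Set.Iio ε) := by
  intro C _ _ J hJ hm D _ Q _ ρ π p hρ hπ hp σ
  obtain ⟨k, ψ, hψ⟩ := hφ C J hJ hm D Q ρ π p hρ hπ hp σ ε F hε
  exact ⟨k, ψ, fun a ha => hψ a ha⟩

variable {C : Type u} [NonUnitalCStarAlgebra C] {D : ℕ → Type u}
  [∀ k, NonUnitalCStarAlgebra (D k)] {Q : Type u} [NonUnitalCStarAlgebra Q]

lemma mem_closure_iUnion_ker_iff {ρ : ∀ k, C →⋆ₙₐ[ℂ] D k} {p : ∀ k, D k →⋆ₙₐ[ℂ] Q}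
    {π : C →⋆ₙₐ[ℂ] Q} (hp : ∀ k c, p k (ρ k c) = π c)
    (hker : ∀ c, π c = 0 → ∀ ε > 0, ∃ k, ‖ρ k c‖ < ε) (c : C) :
    c ∈ closure (⋃ k, (TwoSidedIdeal.ker (ρ k) : Set C)) ↔ π c = 0 := by
  constructor
  · have hle : closure (⋃ k, (TwoSidedIdeal.ker (ρ k) : Set C)) ⊆ TwoSidedIdeal.ker π := by
      refine closure_minimal (Set.iUnion_subset fun k x hx => ?_) (isClosed_ker π)
      have hx' : ρ k x = 0 := (TwoSidedIdeal.mem_ker (ρ k)).1 hx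
      exact (TwoSidedIdeal.mem_ker π).2 (by rw [← hp k, hx', map_zero])
    exact fun hc => (TwoSidedIdeal.mem_ker π).1 (hle hc)
  · refine fun hc => Metric.mem_closure_iff.2 fun ε hε => ?_
    obtain ⟨k, hk⟩ := hker c hc (ε / 2) (by positivity)
    obtain ⟨d, hd, hn⟩ := exists_mem_ker_norm_sub_le (ρ k) c
    refine ⟨d, Set.mem_iUnion.2 ⟨k, (TwoSidedIdeal.mem_ker (ρ k)).2 hd⟩, ?_⟩
    rw [dist_eq_norm]
    linarith

variable {φ : A →⋆ₙₐ[ℂ] B} {S : Set A} {N : Set ℝ}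

lemma LiftsUpTo.exists_lift_of_surjective [TopologicalSpace.SeparableSpace C]
    (hφ : LiftsUpTo φ S N) {ρ : ∀ k, C →⋆ₙₐ[ℂ] D k} (hρ : ∀ k, Function.Surjective (ρ k))
    {p : ∀ k, D k →⋆ₙₐ[ℂ] Q} {π : C →⋆ₙₐ[ℂ] Q} (hπ : Function.Surjective π)
    (hp : ∀ k c, p k (ρ k c) = π c) (hmono : ∀ k c, ρ k c = 0 → ρ (k + 1) c = 0)
    (hker : ∀ c, π c = 0 → ∀ ε > 0, ∃ k, ‖ρ k c‖ < ε) (σ : B →⋆ₙₐ[ℂ] Q) :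
    ∃ (k : ℕ) (ψ : A →⋆ₙₐ[ℂ] D k), ∀ a ∈ S, ‖p k (ψ a) - σ (φ a)‖ ∈ N := by
  have hker_mono : Monotone fun k => TwoSidedIdeal.ker (ρ k) :=
    monotone_nat_of_le_succ fun k c hc =>
      (TwoSidedIdeal.mem_ker (ρ (k + 1))).2 (hmono k c ((TwoSidedIdeal.mem_ker (ρ k)).1 hc))
  exact hφ C _ (fun k => isClosed_ker _) hker_mono D Q ρ π p (fun k => isQuotientBy_ker (hρ k))
    ⟨hπ, mem_closure_iUnion_ker_iff hp hker⟩ (fun k => NonUnitalStarAlgHom.ext (hp k)) σ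

lemma LiftsUpTo.exists_lift_of_separable [TopologicalSpace.SeparableSpace C]
    (hφ : LiftsUpTo φ S N) (ρ : ∀ k, C →⋆ₙₐ[ℂ] D k) (p : ∀ k, D k →⋆ₙₐ[ℂ] Q) (π : C →⋆ₙₐ[ℂ] Q)
    (hp : ∀ k c, p k (ρ k c) = π c) (hmono : ∀ k c, ρ k c = 0 → ρ (k + 1) c = 0)
    (hker : ∀ c, π c = 0 → ∀ ε > 0, ∃ k, ‖ρ k c‖ < ε)
    (σ : B →⋆ₙₐ[ℂ] Q) (hσ : ∀ b, σ b ∈ Set.range π) :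
    ∃ (k : ℕ) (ψ : A →⋆ₙₐ[ℂ] D k), (∀ a ∈ S, ‖p k (ψ a) - σ (φ a)‖ ∈ N) ∧
      ∀ a, ψ a ∈ Set.range (ρ k) := by
  have (k : ℕ) : IsClosed (NonUnitalStarAlgHom.range (ρ k) : Set (D k)) := isClosed_range (ρ k)
  have : IsClosed (NonUnitalStarAlgHom.range π : Set Q) := isClosed_range π
  let ρ' (k : ℕ) : C →⋆ₙₐ[ℂ] NonUnitalStarAlgHom.range (ρ k) :=
    NonUnitalStarAlgHom.codRestrict (ρ k) _ fun c => ⟨c, rfl⟩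
  let π' : C →⋆ₙₐ[ℂ] NonUnitalStarAlgHom.range π :=
    NonUnitalStarAlgHom.codRestrict π _ fun c => ⟨c, rfl⟩
  let p' (k : ℕ) : NonUnitalStarAlgHom.range (ρ k) →⋆ₙₐ[ℂ] NonUnitalStarAlgHom.range π :=
    NonUnitalStarAlgHom.codRestrict ((p k).comp (NonUnitalStarSubalgebraClass.subtype _)) _ (by
      rintro ⟨_, c, rfl⟩
      exact ⟨c, (hp k c).symm⟩)
  obtain ⟨k, ψ, hψ⟩ := hφ.exists_lift_of_surjective (ρ := ρ') (p := p') (π := π')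
    (fun k => by rintro ⟨_, c, rfl⟩; exact ⟨c, rfl⟩) (by rintro ⟨_, c, rfl⟩; exact ⟨c, rfl⟩)
    (fun k c => Subtype.ext (hp k c))
    (fun k c hc => Subtype.ext (hmono k c (congrArg Subtype.val hc)))
    (fun c hc => hker c (congrArg Subtype.val hc)) (NonUnitalStarAlgHom.codRestrict σ _ hσ)
  exact ⟨k, (NonUnitalStarSubalgebraClass.subtype _).comp ψ, hψ, fun a => (ψ a).2⟩

theorem LiftsUpTo.exists_lift [TopologicalSpace.SeparableSpace B]
    (hφ : LiftsUpTo φ S N) (ρ : ∀ k, C →⋆ₙₐ[ℂ] D k) (p : ∀ k, D k →⋆ₙₐ[ℂ] Q) (π : C →⋆ₙₐ[ℂ] Q)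
    (hp : ∀ k c, p k (ρ k c) = π c) (hmono : ∀ k c, ρ k c = 0 → ρ (k + 1) c = 0)
    (hker : ∀ c, π c = 0 → ∀ ε > 0, ∃ k, ‖ρ k c‖ < ε)
    (σ : B →⋆ₙₐ[ℂ] Q) (hσ : ∀ b, σ b ∈ Set.range π) :
    ∃ (k : ℕ) (ψ : A →⋆ₙₐ[ℂ] D k), (∀ a ∈ S, ‖p k (ψ a) - σ (φ a)‖ ∈ N) ∧
      ∀ a, ψ a ∈ Set.range (ρ k) := by
  obtain ⟨b, hb⟩ := TopologicalSpace.exists_dense_seq B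
  choose c hc using fun i => hσ (b i)
  have := separableSpace_generated (Set.countable_range c)
  let j : generated (Set.range c) →⋆ₙₐ[ℂ] C := NonUnitalStarSubalgebraClass.subtype _
  have hclosed : IsClosed (σ ⁻¹' Set.range (π.comp j)) :=
    (isClosed_range _).preimage (map_continuous σ)
  have hdense : Set.range b ⊆ σ ⁻¹' Set.range (π.comp j) := by
    rintro _ ⟨i, rfl⟩
    exact ⟨⟨c i, subset_generated _ ⟨i, rfl⟩⟩, hc i⟩
  obtain ⟨k, ψ, hψ, hrange⟩ := hφ.exists_lift_of_separable (fun k => (ρ k).comp j) p (π.comp j)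
    (fun k c => hp k _) (fun k c => hmono k _) (fun c => hker _) σ
    fun x => closure_minimal hdense hclosed (hb x)
  exact ⟨k, ψ, hψ, fun a => Set.range_comp_subset_range j (ρ k) (hrange a)⟩

end LiftsUpTo

section BoundedProduct

variable {ι B : Type*} {C : ι → Type*} [NonUnitalCStarAlgebra B]
  [∀ i, NonUnitalCStarAlgebra (C i)]

/-- The homomorphism into the bounded product whose coordinates are the given homomorphisms. -/
noncomputable def prodHom (f : ∀ i, B →⋆ₙₐ[ℂ] C i) : B →⋆ₙₐ[ℂ] lp C ∞ where
  toFun b := ⟨fun i => f i b, memℓp_infty ⟨‖b‖, by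
    rintro _ ⟨i, rfl⟩
    exact NonUnitalStarAlgHom.norm_apply_le (f i) b⟩⟩
  map_smul' r b := by ext i; simp
  map_zero' := by ext i; simp
  map_add' a b := by ext i; exact map_add (f i) a b
  map_mul' a b := by ext i; simp
  map_star' b := by ext i; simp [map_star]

@[simp] lemma prodHom_apply (f : ∀ i, B →⋆ₙₐ[ℂ] C i) (b : B) (i : ι) :
    (prodHom f b : ∀ i, C i) i = f i b := rfl

variable (C) in
/-- Evaluation of an element of the bounded product at a coordinate. -/
def coordHom (i : ι) : lp C ∞ →⋆ₙₐ[ℂ] C i where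
  toFun x := x i
  map_smul' _ _ := rfl
  map_zero' := rfl
  map_add' _ _ := rfl
  map_mul' _ _ := rfl
  map_star' _ := rfl

@[simp] lemma coordHom_apply (i : ι) (x : lp C ∞) : coordHom C i x = x i := rfl

end BoundedProduct

section AsymptoticGraph

variable {C : ℕ → Type u} [∀ n, NonUnitalCStarAlgebra (C n)]

open Classical in
/-- The truncation of a bounded sequence which sets the coordinates below `k` to zero. -/
noncomputable def truncHom (k : ℕ) : lp C ∞ →⋆ₙₐ[ℂ] lp C ∞ :=
  prodHom fun n => if k ≤ n then coordHom C n else 0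

lemma truncHom_apply_of_le {k n : ℕ} (h : k ≤ n) (x : lp C ∞) :
    (truncHom k x : ∀ n, C n) n = x n := by
  simp [truncHom, h]

lemma truncHom_apply_of_lt {k n : ℕ} (h : n < k) (x : lp C ∞) :
    (truncHom k x : ∀ n, C n) n = 0 := by
  simp [truncHom, not_le.2 h]

lemma norm_truncHom_le {k : ℕ} {x : lp C ∞} {r : ℝ} (hr : 0 ≤ r) (h : ∀ n ≥ k, ‖x n‖ ≤ r) :
    ‖truncHom k x‖ ≤ r := by
  refine lp.norm_le_of_forall_le hr fun n => ?_
  rcases le_or_gt k n with hn | hn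
  · rw [truncHom_apply_of_le hn]
    exact h n hn
  · rw [truncHom_apply_of_lt hn, norm_zero]
    exact hr

lemma truncHom_succ_eq_zero {k : ℕ} {x : lp C ∞} (h : truncHom k x = 0) :
    truncHom (k + 1) x = 0 := by
  ext n
  rcases le_or_gt (k + 1) n with hn | hn
  · rw [truncHom_apply_of_le hn, ← truncHom_apply_of_le (Nat.le_of_succ_le hn), h]
  · rw [truncHom_apply_of_lt hn]
    rfl

variable {A B G : Type u} [NonUnitalCStarAlgebra A] [NonUnitalCStarAlgebra B]
  [NonUnitalCStarAlgebra G]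

/-- A subalgebra `R` of `(∏ C n) × G` is the graph of an asymptotic morphism from a subalgebra of
`G` to the sequence `C` if `‖z.1 n‖` is asymptotically controlled by `‖z.2‖` for `z ∈ R`. -/
def IsAsymptoticGraph (R : NonUnitalStarSubalgebra ℂ (lp C ∞ × G)) : Prop :=
  ∃ K : ℝ≥0, ∀ z ∈ R, ∀ ε > 0, ∀ᶠ n in atTop, ‖z.1 n‖ ≤ K * ‖z.2‖ + ε

lemma IsAsymptoticGraph.topologicalClosure {R : NonUnitalStarSubalgebra ℂ (lp C ∞ × G)}
    (hR : IsAsymptoticGraph R) : IsAsymptoticGraph R.topologicalClosure := by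
  obtain ⟨K, hK⟩ := hR
  refine ⟨K, fun z hz ε hε => ?_⟩
  obtain ⟨w, hw, hzw⟩ := Metric.mem_closure_iff.1 hz (ε / (2 * (K + 1))) (by positivity)
  rw [dist_eq_norm] at hzw
  filter_upwards [hK w hw (ε / 2) (by positivity)] with n hn
  have hfst : ‖z.1 n - w.1 n‖ ≤ ‖z - w‖ :=
    (lp.norm_apply_le_norm (by simp) (z.1 - w.1) n).trans (norm_fst_le (z - w))
  have hsnd : ‖w.2‖ ≤ ‖z.2‖ + ‖z - w‖ :=
    norm_le_norm_add_norm_sub' .. |>.trans <| by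
      gcongr; rw [norm_sub_rev]; exact norm_snd_le (z - w)
  calc ‖z.1 n‖ ≤ ‖w.1 n‖ + ‖z.1 n - w.1 n‖ := norm_le_norm_add_norm_sub' _ _
    _ ≤ (K * (‖z.2‖ + ‖z - w‖) + ε / 2) + ‖z - w‖ := by
      gcongr
      exact hn.trans (by gcongr)
    _ = K * ‖z.2‖ + (K + 1) * ‖z - w‖ + ε / 2 := by ring
    _ ≤ K * ‖z.2‖ + (K + 1) * (ε / (2 * (K + 1))) + ε / 2 := by gcongr
    _ = K * ‖z.2‖ + ε := by field_simp; ring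

lemma IsAsymptoticGraph.exists_norm_truncHom_lt {R : NonUnitalStarSubalgebra ℂ (lp C ∞ × G)}
    (hR : IsAsymptoticGraph R) {z : lp C ∞ × G} (hz : z ∈ R) (hz₀ : z.2 = 0) {ε : ℝ} (hε : 0 < ε) :
    ∃ k, ‖truncHom k z.1‖ < ε := by
  obtain ⟨K, hK⟩ := hR
  obtain ⟨k, hk⟩ := eventually_atTop.1 (hK z hz (ε / 2) (half_pos hε))
  refine ⟨k, (norm_truncHom_le (half_pos hε).le fun n hn => ?_).trans_lt (half_lt_self hε)⟩
  simpa [hz₀] using hk n hn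

/-- The lifting property is applied to the closure of `R`, to the kernels of the truncations
`z ↦ (truncHom k z.1, z.2)` and to the quotient map `z ↦ z.2`. -/
theorem LiftsUpTo.exists_lift_of_isAsymptoticGraph [TopologicalSpace.SeparableSpace B]
    {φ : A →⋆ₙₐ[ℂ] B} {S : Set A} {N : Set ℝ} (hφ : LiftsUpTo φ S N)
    {R : NonUnitalStarSubalgebra ℂ (lp C ∞ × G)} (hR : IsAsymptoticGraph R)
    (τ : B →⋆ₙₐ[ℂ] G) (hτ : ∀ b, τ b ∈ closure (Prod.snd '' (R : Set (lp C ∞ × G)))) :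
    ∃ (k : ℕ) (ψ : A →⋆ₙₐ[ℂ] lp C ∞) (χ : A →⋆ₙₐ[ℂ] G),
      (∀ a ∈ S, ‖χ a - τ (φ a)‖ ∈ N) ∧
      ∀ a, ∃ x, (x, χ a) ∈ closure (R : Set (lp C ∞ × G)) ∧ ∀ n ≥ k, ψ a n = x n := by
  have : IsClosed (R.topologicalClosure : Set (lp C ∞ × G)) := R.isClosed_topologicalClosure
  let j : R.topologicalClosure →⋆ₙₐ[ℂ] lp C ∞ × G := NonUnitalStarSubalgebraClass.subtype _
  let fst : lp C ∞ × G →⋆ₙₐ[ℂ] lp C ∞ := NonUnitalStarAlgHom.fst ℂ _ _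
  let snd : lp C ∞ × G →⋆ₙₐ[ℂ] G := NonUnitalStarAlgHom.snd ℂ _ _
  let ρ (k : ℕ) : R.topologicalClosure →⋆ₙₐ[ℂ] lp C ∞ × G :=
    (NonUnitalStarAlgHom.prod ((truncHom k).comp fst) snd).comp j
  have hmono (k : ℕ) (z : R.topologicalClosure) (hz : ρ k z = 0) : ρ (k + 1) z = 0 :=
    Prod.ext (truncHom_succ_eq_zero (congrArg Prod.fst hz)) (congrArg Prod.snd hz :)
  have hker (z : R.topologicalClosure) (hz : (j z).2 = 0) (ε : ℝ) (hε : 0 < ε) :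
      ∃ k, ‖ρ k z‖ < ε := by
    obtain ⟨k, hk⟩ := hR.topologicalClosure.exists_norm_truncHom_lt z.2 hz hε
    refine ⟨k, max_lt hk ?_⟩
    rwa [show (ρ k z).2 = 0 from hz, norm_zero]
  have hrange : closure (Prod.snd '' (R : Set (lp C ∞ × G))) ⊆ Set.range (snd.comp j) := by
    refine closure_minimal ?_ (isClosed_range _)
    rintro _ ⟨z, hz, rfl⟩
    exact ⟨⟨z, R.le_topologicalClosure hz⟩, rfl⟩
  obtain ⟨k, ψ, hψ, hψρ⟩ := hφ.exists_lift ρ (fun _ => snd) (snd.comp j) (fun _ _ => rfl) hmono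
    hker τ fun b => hrange (hτ b)
  refine ⟨k, fst.comp ψ, snd.comp ψ, hψ, fun a => ?_⟩
  obtain ⟨z, hz⟩ := hψρ a
  have hsnd : snd (ψ a) = (j z).2 := (congrArg Prod.snd hz).symm
  have hfst : fst (ψ a) = truncHom k (j z).1 := (congrArg Prod.fst hz).symm
  refine ⟨(j z).1, ?_, fun n hn => ?_⟩
  · rw [NonUnitalStarAlgHom.comp_apply, hsnd]
    exact z.2
  · rw [NonUnitalStarAlgHom.comp_apply, hfst, truncHom_apply_of_le hn]

theorem SemiprojectiveHom.exists_lift_of_isAsymptoticGraph [TopologicalSpace.SeparableSpace B]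
    {φ : A →⋆ₙₐ[ℂ] B} (hφ : SemiprojectiveHom φ)
    {R : NonUnitalStarSubalgebra ℂ (lp C ∞ × G)} (hR : IsAsymptoticGraph R)
    (τ : B →⋆ₙₐ[ℂ] G) (hτ : ∀ b, τ b ∈ closure (Prod.snd '' (R : Set (lp C ∞ × G))))
    {Q : ℕ → Type*} [∀ n, NonUnitalCStarAlgebra (Q n)] (π : ∀ n, C n →⋆ₙₐ[ℂ] Q n)
    (σ : ∀ n, G →⋆ₙₐ[ℂ] Q n) (hπ : ∀ z ∈ R, ∀ n, π n (z.1 n) = σ n z.2) :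
    ∃ (n : ℕ) (ψ : A →⋆ₙₐ[ℂ] C n), ∀ a, π n (ψ a) = σ n (τ (φ a)) := by
  obtain ⟨k, ψ, χ, hχ, hψ⟩ := hφ.liftsUpTo.exists_lift_of_isAsymptoticGraph hR τ hτ
  refine ⟨k, (coordHom C k).comp ψ, fun a => ?_⟩
  obtain ⟨x, hx, hxψ⟩ := hψ a
  have hχa : χ a = τ (φ a) := sub_eq_zero.1 (norm_eq_zero.1 (hχ a (Set.mem_univ a)))
  have hclosure : closure (R : Set (lp C ∞ × G)) ⊆ {z | π k (z.1 k) = σ k z.2} :=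
    closure_minimal (fun z hz => hπ z hz k) <| isClosed_eq
      ((map_continuous ((π k).comp (coordHom C k))).comp continuous_fst)
      ((map_continuous (σ k)).comp continuous_snd)
  rw [NonUnitalStarAlgHom.comp_apply, coordHom_apply, hxψ k le_rfl, ← hχa]
  exact hclosure hx

end AsymptoticGraph

section NullSequences

variable (C : ℕ → Type*) [∀ n, NonUnitalCStarAlgebra (C n)]

/-- The ideal `c₀` of the bounded product consisting of the sequences converging to zero. -/
noncomputable def nullSequences : TwoSidedIdeal (lp C ∞) :=
  .mk' {x | Tendsto (fun n => ‖x n‖) atTop (𝓝 0)}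
    (by simp)
    (fun hx hy => squeeze_zero (fun _ => norm_nonneg _) (fun n => norm_add_le _ _)
      (by simpa using hx.add hy))
    (by simp)
    (fun {x y} hy => squeeze_zero (fun _ => norm_nonneg _)
      (fun n => (norm_mul_le (x n) (y n)).trans
        (mul_le_mul_of_nonneg_right (lp.norm_apply_le_norm (by simp) x n) (norm_nonneg _)))
      (by simpa using Tendsto.const_mul ‖x‖ hy))
    (fun {x y} hx => squeeze_zero (fun _ => norm_nonneg _)
      (fun n => (norm_mul_le (x n) (y n)).trans
        (mul_le_mul_of_nonneg_left (lp.norm_apply_le_norm (by simp) y n) (norm_nonneg _)))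
      (by simpa using Tendsto.mul_const ‖y‖ hx))

variable {C}

lemma mem_nullSequences {x : lp C ∞} :
    x ∈ nullSequences C ↔ Tendsto (fun n => ‖x n‖) atTop (𝓝 0) :=
  TwoSidedIdeal.mem_mk' ..

lemma smul_mem_nullSequences (r : ℂ) {x : lp C ∞} (hx : x ∈ nullSequences C) :
    r • x ∈ nullSequences C := by
  rw [mem_nullSequences] at hx ⊢
  simpa [norm_smul] using hx.const_mul ‖r‖

lemma star_mem_nullSequences {x : lp C ∞} (hx : x ∈ nullSequences C) :
    star x ∈ nullSequences C := by
  rw [mem_nullSequences] at hx ⊢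
  simpa using hx

lemma eventually_norm_lt_of_mem_nullSequences {x : lp C ∞} (hx : x ∈ nullSequences C) {ε : ℝ}
    (hε : 0 < ε) : ∀ᶠ n in atTop, ‖x n‖ < ε :=
  (mem_nullSequences.1 hx).eventually (gt_mem_nhds hε)

lemma mem_nullSequences_of_eventually_le {x : lp C ∞}
    (hx : ∀ᶠ n in atTop, ‖x n‖ ≤ 1 / ((n : ℝ) + 1)) : x ∈ nullSequences C :=
  mem_nullSequences.2 (squeeze_zero' (.of_forall fun _ => norm_nonneg _) hx
    tendsto_one_div_add_atTop_nhds_zero_nat)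

lemma isClosed_nullSequences : IsClosed (nullSequences C : Set (lp C ∞)) := by
  refine isClosed_of_closure_subset fun x hx => mem_nullSequences.2 ?_
  refine Metric.tendsto_nhds.2 fun ε hε => ?_
  obtain ⟨y, hy, hxy⟩ := Metric.mem_closure_iff.1 hx (ε / 2) (by positivity)
  filter_upwards [eventually_norm_lt_of_mem_nullSequences hy (half_pos hε)] with n hn
  have hxyn : ‖x n - y n‖ ≤ dist x y := by
    rw [dist_eq_norm]
    exact lp.norm_apply_le_norm (by simp) (x - y) n
  rw [dist_zero_right, norm_norm]
  linarith [norm_le_norm_add_norm_sub' (x n) (y n)]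

variable {E : Type*} [NonUnitalCStarAlgebra E]

/-- The elements on which two homomorphisms into the bounded product agree modulo `c₀`. -/
def asymptoticEqualizer (f g : E →⋆ₙₐ[ℂ] lp C ∞) : NonUnitalStarSubalgebra ℂ E where
  carrier := {z | f z - g z ∈ nullSequences C}
  add_mem' {a b} ha hb := by
    have hab : f (a + b) - g (a + b) = (f a - g a) + (f b - g b) := by
      rw [map_add, map_add]; abel
    simpa only [Set.mem_ofPred_eq, hab] using (nullSequences C).add_mem ha hb
  zero_mem' := by simp
  mul_mem' {a b} ha hb := by
    have hab : f (a * b) - g (a * b) = (f a - g a) * f b + g a * (f b - g b) := by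
      rw [map_mul, map_mul]; noncomm_ring
    simpa only [Set.mem_ofPred_eq, hab] using (nullSequences C).add_mem
      ((nullSequences C).mul_mem_right _ _ ha) ((nullSequences C).mul_mem_left _ _ hb)
  smul_mem' r a ha := by
    simpa only [Set.mem_ofPred_eq, map_smul, smul_sub] using smul_mem_nullSequences r ha
  star_mem' {a} ha := by
    simpa only [Set.mem_ofPred_eq, map_star, star_sub] using star_mem_nullSequences ha

lemma mem_asymptoticEqualizer {f g : E →⋆ₙₐ[ℂ] lp C ∞} {z : E} :
    z ∈ asymptoticEqualizer f g ↔ f z - g z ∈ nullSequences C := Iff.rfl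

lemma isClosed_asymptoticEqualizer (f g : E →⋆ₙₐ[ℂ] lp C ∞) :
    IsClosed (asymptoticEqualizer f g : Set E) :=
  isClosed_nullSequences.preimage ((map_continuous f).sub (map_continuous g))

end NullSequences

section Homotopy

variable {A B D : Type u} [NonUnitalCStarAlgebra A] [NonUnitalCStarAlgebra B]
  [NonUnitalCStarAlgebra D]

lemma homotopic_iff_joinedIn {φ ψ : A →⋆ₙₐ[ℂ] B} :
    Homotopic φ ψ ↔ JoinedIn (Set.range ((⇑) : (A →⋆ₙₐ[ℂ] B) → A → B)) φ ψ := by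
  constructor
  · rintro ⟨H, hH, rfl, rfl⟩
    exact ⟨⟨⟨fun t => H t, continuous_pi hH⟩, rfl, rfl⟩, fun t => ⟨H t, rfl⟩⟩
  · rintro ⟨γ, hγ⟩
    choose H hH using hγ
    refine ⟨H, fun a => ?_, DFunLike.coe_injective ?_, DFunLike.coe_injective ?_⟩
    · simp only [hH]
      exact (continuous_apply a).comp γ.continuous
    · rw [hH, γ.source]
    · rw [hH, γ.target]

lemma Homotopic.refl (φ : A →⋆ₙₐ[ℂ] B) : Homotopic φ φ :=
  homotopic_iff_joinedIn.2 (JoinedIn.refl ⟨φ, rfl⟩)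

lemma Homotopic.symm {φ ψ : A →⋆ₙₐ[ℂ] B} (h : Homotopic φ ψ) : Homotopic ψ φ :=
  homotopic_iff_joinedIn.2 (homotopic_iff_joinedIn.1 h).symm

lemma Homotopic.trans {φ ψ χ : A →⋆ₙₐ[ℂ] B} (h : Homotopic φ ψ) (h' : Homotopic ψ χ) :
    Homotopic φ χ :=
  homotopic_iff_joinedIn.2 ((homotopic_iff_joinedIn.1 h).trans (homotopic_iff_joinedIn.1 h'))

lemma Homotopic.comp_left {φ ψ : A →⋆ₙₐ[ℂ] B} (h : Homotopic φ ψ) (χ : B →⋆ₙₐ[ℂ] D) :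
    Homotopic (χ.comp φ) (χ.comp ψ) := by
  obtain ⟨H, hH, rfl, rfl⟩ := h
  exact ⟨fun t => χ.comp (H t), fun a => (map_continuous χ).comp (hH a), rfl, rfl⟩

lemma Homotopic.comp_right {φ ψ : B →⋆ₙₐ[ℂ] D} (h : Homotopic φ ψ) (χ : A →⋆ₙₐ[ℂ] B) :
    Homotopic (φ.comp χ) (ψ.comp χ) := by
  obtain ⟨H, hH, rfl, rfl⟩ := h
  exact ⟨fun t => (H t).comp χ, fun a => hH (χ a), rfl, rfl⟩

/-- Evaluation of paths at a time `t`. -/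
def evalHom (B : Type*) [NonUnitalCStarAlgebra B] (t : unitInterval) :
    C(unitInterval, B) →⋆ₙₐ[ℂ] B where
  toFun f := f t
  map_smul' _ _ := rfl
  map_zero' := rfl
  map_add' _ _ := rfl
  map_mul' _ _ := rfl
  map_star' _ := rfl

@[simp] lemma evalHom_apply {B : Type*} [NonUnitalCStarAlgebra B] (t : unitInterval)
    (f : C(unitInterval, B)) : evalHom B t f = f t := rfl

/-- A homotopy as a homomorphism into the algebra of paths. -/
def pathHom (H : unitInterval → (A →⋆ₙₐ[ℂ] B)) (hH : ∀ a, Continuous fun t => H t a) :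
    A →⋆ₙₐ[ℂ] C(unitInterval, B) where
  toFun a := ⟨fun t => H t a, hH a⟩
  map_smul' r a := by ext t; simp
  map_zero' := by ext t; simp
  map_add' a b := by ext t; simp
  map_mul' a b := by ext t; simp
  map_star' a := by ext t; simp [map_star]

@[simp] lemma pathHom_apply (H : unitInterval → (A →⋆ₙₐ[ℂ] B))
    (hH : ∀ a, Continuous fun t => H t a) (a : A) (t : unitInterval) :
    pathHom H hH a t = H t a := rfl

lemma homotopic_of_path (ψ : A →⋆ₙₐ[ℂ] C(unitInterval, B)) :
    Homotopic ((evalHom B 0).comp ψ) ((evalHom B 1).comp ψ) :=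
  ⟨fun t => (evalHom B t).comp ψ, fun a => (ψ a).continuous, rfl, rfl⟩

end Homotopy

section ApproximateLifts

variable {A B : Type u} [NonUnitalCStarAlgebra A] [NonUnitalCStarAlgebra B]
  {C : ℕ → Type u} [∀ n, NonUnitalCStarAlgebra (C n)]
  {Q : ℕ → Type*} [∀ n, NonUnitalCStarAlgebra (Q n)]

/-- The pairs of a sequence `x` and an element `b` such that `x n` is a lift of `σ n b` along `π n`
and `x` is asymptotic to the sequence of the `ψ n b`. -/
noncomputable def approxLifts (π : ∀ n, C n →⋆ₙₐ[ℂ] Q n) (σ : ∀ n, B →⋆ₙₐ[ℂ] Q n)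
    (ψ : ∀ n, B →⋆ₙₐ[ℂ] C n) : NonUnitalStarSubalgebra ℂ (lp C ∞ × B) :=
  asymptoticEqualizer (NonUnitalStarAlgHom.fst ℂ _ _)
      ((prodHom ψ).comp (NonUnitalStarAlgHom.snd ℂ _ _)) ⊓
    ⨅ n, NonUnitalStarAlgHom.equalizer
      (((π n).comp (coordHom C n)).comp (NonUnitalStarAlgHom.fst ℂ _ _))
      ((σ n).comp (NonUnitalStarAlgHom.snd ℂ _ _))

variable {π : ∀ n, C n →⋆ₙₐ[ℂ] Q n} {σ : ∀ n, B →⋆ₙₐ[ℂ] Q n} {ψ : ∀ n, B →⋆ₙₐ[ℂ] C n}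

lemma mem_approxLifts {z : lp C ∞ × B} :
    z ∈ approxLifts π σ ψ ↔
      z.1 - prodHom ψ z.2 ∈ nullSequences C ∧ ∀ n, π n (z.1 n) = σ n z.2 := by
  rw [approxLifts, NonUnitalStarAlgebra.mem_inf, mem_asymptoticEqualizer,
    NonUnitalStarAlgebra.mem_iInf]
  simp

lemma isAsymptoticGraph_approxLifts : IsAsymptoticGraph (approxLifts π σ ψ) := by
  refine ⟨1, fun z hz ε hε => ?_⟩
  filter_upwards [eventually_norm_lt_of_mem_nullSequences (mem_approxLifts.1 hz).1 hε] with n hn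
  have hψ : ‖ψ n z.2‖ ≤ ‖z.2‖ := NonUnitalStarAlgHom.norm_apply_le _ _
  have hn' : ‖z.1 n - ψ n z.2‖ < ε := hn
  rw [NNReal.coe_one, one_mul]
  linarith [norm_le_norm_add_norm_sub' (z.1 n) (ψ n z.2)]

lemma exists_mem_approxLifts (hπ : ∀ n, Function.Surjective (π n)) {b : B}
    (hb : Tendsto (fun n => ‖σ n b - π n (ψ n b)‖) atTop (𝓝 0)) :
    ∃ x, (x, b) ∈ approxLifts π σ ψ := by
  choose d hd hdnorm using fun n => exists_preimage_norm_le (π n) (hπ n (σ n b - π n (ψ n b)))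
  obtain ⟨M, hM⟩ := hb.bddAbove_range
  have hbound (n : ℕ) : ‖d n‖ ≤ 2 * M :=
    (hdnorm n).trans (mul_le_mul_of_nonneg_left (hM ⟨n, rfl⟩) zero_le_two)
  let x : lp C ∞ := ⟨d, memℓp_infty ⟨2 * M, Set.forall_mem_range.2 hbound⟩⟩
  refine ⟨x + prodHom ψ b, mem_approxLifts.2 ⟨?_, fun n => ?_⟩⟩
  · rw [add_sub_cancel_right, mem_nullSequences]
    exact squeeze_zero (fun _ => norm_nonneg _) hdnorm (by simpa using hb.const_mul 2)
  · change π n (d n + ψ n b) = σ n b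
    rw [map_add, hd, sub_add_cancel]

theorem SemiprojectiveHom.exists_lift_of_tendsto [TopologicalSpace.SeparableSpace B]
    {φ : A →⋆ₙₐ[ℂ] B} (hφ : SemiprojectiveHom φ) (hπ : ∀ n, Function.Surjective (π n))
    (hψ : ∀ b, Tendsto (fun n => ‖σ n b - π n (ψ n b)‖) atTop (𝓝 0)) :
    ∃ (n : ℕ) (χ : A →⋆ₙₐ[ℂ] C n), (π n).comp χ = (σ n).comp φ := by
  have hdom (b : B) : b ∈ Prod.snd '' (approxLifts π σ ψ : Set (lp C ∞ × B)) := by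
    obtain ⟨x, hx⟩ := exists_mem_approxLifts hπ (hψ b)
    exact ⟨_, hx, rfl⟩
  obtain ⟨n, χ, hχ⟩ := hφ.exists_lift_of_isAsymptoticGraph isAsymptoticGraph_approxLifts
    (NonUnitalStarAlgHom.id ℂ B) (fun b => subset_closure (hdom b)) π σ
    (fun z hz => (mem_approxLifts.1 hz).2)
  exact ⟨n, χ, NonUnitalStarAlgHom.ext hχ⟩

lemma surjective_prod_evalHom_zero_one (B : Type*) [NonUnitalCStarAlgebra B] :
    Function.Surjective (NonUnitalStarAlgHom.prod (evalHom B 0) (evalHom B 1)) := fun b =>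
  ⟨⟨fun t => ((1 - t : ℝ) : ℂ) • b.1 + ((t : ℝ) : ℂ) • b.2, by fun_prop⟩, by simp⟩

theorem SemiprojectiveHom.exists_homotopic_zero [TopologicalSpace.SeparableSpace B]
    {φ : A →⋆ₙₐ[ℂ] B} (hφ : SemiprojectiveHom φ) {γ : ∀ n, B →⋆ₙₐ[ℂ] C n}
    (hγ : ∀ b, Tendsto (fun n => ‖γ n b‖) atTop (𝓝 0)) :
    ∃ n, Homotopic ((γ n).comp φ) 0 := by
  obtain ⟨n, ψ, hψ⟩ := hφ.exists_lift_of_tendsto (C := fun n => C(unitInterval, C n))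
    (σ := fun n => NonUnitalStarAlgHom.prod (γ n) 0) (ψ := fun n => 0)
    (fun n => surjective_prod_evalHom_zero_one (C n)) (by simpa [Prod.norm_def] using hγ)
  have h₀ : (evalHom (C n) 0).comp ψ = (γ n).comp φ :=
    NonUnitalStarAlgHom.ext fun a => congrArg Prod.fst (DFunLike.congr_fun hψ a)
  have h₁ : (evalHom (C n) 1).comp ψ = 0 :=
    NonUnitalStarAlgHom.ext fun a => congrArg Prod.snd (DFunLike.congr_fun hψ a)
  exact ⟨n, h₀ ▸ h₁ ▸ homotopic_of_path ψ⟩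

end ApproximateLifts

namespace InductiveSystem

variable (S : InductiveSystem.{u})

lemma trans_self (k : ℕ) : S.trans (le_refl k) = NonUnitalStarAlgHom.id ℂ (S.obj k) :=
  Nat.leRecOn_self _

lemma trans_succ {k l : ℕ} (h : k ≤ l) (h' : k ≤ l + 1) :
    S.trans h' = (S.map l).comp (S.trans h) :=
  Nat.leRecOn_succ h _

lemma trans_trans {k l m : ℕ} (h : k ≤ l) (h' : l ≤ m) :
    S.trans (h.trans h') = (S.trans h').comp (S.trans h) := by
  induction m, h' using Nat.le_induction with
  | base => rw [trans_self]; rfl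
  | succ m hm ih => rw [S.trans_succ (h.trans hm), S.trans_succ hm, ih]; rfl

lemma trans_trans_apply {k l m : ℕ} (h : k ≤ l) (h' : l ≤ m) (a : S.obj k) :
    S.trans h' (S.trans h a) = S.trans (h.trans h') a :=
  (DFunLike.congr_fun (S.trans_trans h h') a).symm

lemma trans_succ_self (k : ℕ) : S.trans (Nat.le_succ k) = S.map k := by
  rw [S.trans_succ (le_refl k), trans_self]; rfl

variable {S} {A : Type u} [NonUnitalCStarAlgebra A] {ι : ∀ k, S.obj k →⋆ₙₐ[ℂ] A}

lemma IsLimit.comp_trans (h : S.IsLimit A ι) {k l : ℕ} (hkl : k ≤ l) :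
    (ι l).comp (S.trans hkl) = ι k := by
  induction l, hkl using Nat.le_induction with
  | base => rw [trans_self]; rfl
  | succ l hl ih => rw [S.trans_succ hl, ← ih, ← h.compat l]; rfl

lemma IsLimit.apply_trans (h : S.IsLimit A ι) {k l : ℕ} (hkl : k ≤ l) (a : S.obj k) :
    ι l (S.trans hkl a) = ι k a :=
  DFunLike.congr_fun (h.comp_trans hkl) a

lemma IsLimit.eventually_norm_trans_le (h : S.IsLimit A ι) (k : ℕ) (a : S.obj k) {ε : ℝ}
    (hε : 0 < ε) : ∀ᶠ n in atTop, ∀ hn : k ≤ n, ‖S.trans hn a‖ ≤ ‖ι k a‖ + ε := by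
  obtain ⟨m, hm⟩ := eventually_atTop.1
    ((h.norm_tendsto k a).eventually (gt_mem_nhds (lt_add_of_pos_right _ hε)))
  refine eventually_atTop.2 ⟨k + m, fun n hn hkn => ?_⟩
  obtain ⟨i, rfl⟩ := Nat.exists_eq_add_of_le hkn
  exact (hm i (by omega)).le

theorem IsShapeSystem.exists_homotopic_zero (hS : S.IsShapeSystem PUnit.{u + 1}) (k : ℕ) :
    ∃ l, ∃ h : k ≤ l, Homotopic (S.trans h) 0 := by
  obtain ⟨⟨ι, hι⟩, hsemi⟩ := hS
  have hnull (b : S.obj (k + 1)) :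
      Tendsto (fun n => ‖S.trans (Nat.le_add_right (k + 1) n) b‖) atTop (𝓝 0) := by
    simpa [Subsingleton.elim (ι (k + 1) b) 0] using hι.norm_tendsto (k + 1) b
  obtain ⟨n, hn⟩ := (hsemi k).exists_homotopic_zero hnull
  refine ⟨k + 1 + n, by omega, ?_⟩
  rwa [S.trans_trans (Nat.le_succ k) (Nat.le_add_right (k + 1) n), S.trans_succ_self]

end InductiveSystem

section CoherentSequences

variable {S : InductiveSystem.{u}} {A : Type u} [NonUnitalCStarAlgebra A]
  {ι : ∀ k, S.obj k →⋆ₙₐ[ℂ] A}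

/-- The sequences that are eventually coherent in an inductive system, paired with their limit. -/
def coherentSequences (hι : S.IsLimit A ι) : NonUnitalStarSubalgebra ℂ (lp S.obj ∞ × A) where
  carrier := {z | ∃ k b, z.2 = ι k b ∧ ∀ n (h : k ≤ n), z.1 n = S.trans h b}
  add_mem' := by
    rintro x y ⟨k, b, hb, hb'⟩ ⟨l, c, hc, hc'⟩
    refine ⟨max k l, S.trans (le_max_left _ _) b + S.trans (le_max_right _ _) c, ?_, fun n h => ?_⟩
    · simp [hι.apply_trans, hb, hc]
    · simp [S.trans_trans_apply, hb' n ((le_max_left _ _).trans h),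
        hc' n ((le_max_right _ _).trans h)]
  zero_mem' := ⟨0, 0, by simp, fun n h => by simp⟩
  mul_mem' := by
    rintro x y ⟨k, b, hb, hb'⟩ ⟨l, c, hc, hc'⟩
    refine ⟨max k l, S.trans (le_max_left _ _) b * S.trans (le_max_right _ _) c, ?_, fun n h => ?_⟩
    · simp [hι.apply_trans, hb, hc]
    · simp [S.trans_trans_apply, hb' n ((le_max_left _ _).trans h),
        hc' n ((le_max_right _ _).trans h)]
  smul_mem' := by
    rintro r x ⟨k, b, hb, hb'⟩
    exact ⟨k, r • b, by simp [hb], fun n h => by simp [hb' n h]⟩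
  star_mem' := by
    rintro x ⟨k, b, hb, hb'⟩
    exact ⟨k, star b, by simp [hb, map_star], fun n h => by simp [hb' n h, map_star]⟩

lemma isAsymptoticGraph_coherentSequences (hι : S.IsLimit A ι) :
    IsAsymptoticGraph (coherentSequences hι) := by
  refine ⟨1, ?_⟩
  rintro z ⟨k, b, hb, hb'⟩ ε hε
  filter_upwards [hι.eventually_norm_trans_le k b hε, eventually_ge_atTop k] with n hn hkn
  rw [hb' n hkn, hb, NNReal.coe_one, one_mul]
  exact hn hkn

lemma dense_snd_coherentSequences (hι : S.IsLimit A ι) :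
    Dense (Prod.snd '' (coherentSequences hι : Set (lp S.obj ∞ × A))) := by
  classical
  refine hι.dense.mono ?_
  rintro _ ⟨_, ⟨k, rfl⟩, b, rfl⟩
  exact ⟨(prodHom (fun n => if h : k ≤ n then S.trans h else 0) b, ι k b),
    ⟨k, b, rfl, fun n h => by simp [h]⟩, rfl⟩

lemma tendsto_of_mem_closure_coherentSequences (hι : S.IsLimit A ι)
    {z : lp S.obj ∞ × A} (hz : z ∈ closure (coherentSequences hι : Set (lp S.obj ∞ × A))) :
    Tendsto (fun n => ‖ι n (z.1 n) - z.2‖) atTop (𝓝 0) := by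
  let ιfst : lp S.obj ∞ × A →⋆ₙₐ[ℂ] lp (fun _ : ℕ => A) ∞ :=
    prodHom fun n => ((ι n).comp (coordHom S.obj n)).comp (NonUnitalStarAlgHom.fst ℂ _ _)
  let snd : lp S.obj ∞ × A →⋆ₙₐ[ℂ] lp (fun _ : ℕ => A) ∞ :=
    prodHom fun _ => NonUnitalStarAlgHom.snd ℂ _ _
  have hle : (coherentSequences hι : Set (lp S.obj ∞ × A)) ⊆ asymptoticEqualizer ιfst snd := by
    rintro y ⟨k, b, hb, hb'⟩
    refine mem_nullSequences.2 (tendsto_const_nhds.congr' ?_)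
    filter_upwards [eventually_ge_atTop k] with n hn
    simp [ιfst, snd, hb' n hn, hb, hι.apply_trans]
  exact mem_nullSequences.1 (closure_minimal hle (isClosed_asymptoticEqualizer ιfst snd) hz)

theorem InductiveSystem.IsLimit.exists_approx_section [TopologicalSpace.SeparableSpace A]
    (hι : S.IsLimit A ι) (hA : IsWeaklySemiprojective A) (F : Finset A) {ε : ℝ} (hε : 0 < ε) :
    ∃ (n : ℕ) (ψ : A →⋆ₙₐ[ℂ] S.obj n), ∀ a ∈ F, ‖ι n (ψ a) - a‖ < ε := by
  obtain ⟨k, ψ, χ, hχ, hψ⟩ := (hA.liftsUpTo F (half_pos hε)).exists_lift_of_isAsymptoticGraph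
    (isAsymptoticGraph_coherentSequences hι) (NonUnitalStarAlgHom.id ℂ A)
    (dense_snd_coherentSequences hι)
  have hev : ∀ᶠ n in atTop, ∀ a ∈ F, ‖ι n (ψ a n) - χ a‖ < ε / 2 := by
    refine (Finset.eventually_all F).2 fun a _ => ?_
    obtain ⟨x, hx, hxψ⟩ := hψ a
    filter_upwards [(tendsto_of_mem_closure_coherentSequences hι hx).eventually
      (gt_mem_nhds (half_pos hε)), eventually_ge_atTop k] with n hn hkn
    rwa [hxψ n hkn]
  obtain ⟨n, hn⟩ := hev.exists
  refine ⟨n, (coordHom S.obj n).comp ψ, fun a ha => ?_⟩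
  have hχa : ‖χ a - a‖ < ε / 2 := hχ a ha
  calc ‖ι n (ψ a n) - a‖ ≤ ‖ι n (ψ a n) - χ a‖ + ‖χ a - a‖ := norm_sub_le_norm_sub_add_norm_sub ..
    _ < ε / 2 + ε / 2 := add_lt_add (hn a ha) hχa
    _ = ε := add_halves ε

end CoherentSequences

section Implications

variable {A B : Type u} [NonUnitalCStarAlgebra A] [NonUnitalCStarAlgebra B] {φ : A →⋆ₙₐ[ℂ] B}

lemma ProjectiveHom.weaklyProjectiveHom (hφ : ProjectiveHom φ) : WeaklyProjectiveHom φ := by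
  intro C Q _ _ _ J π hJ hπ σ ε F hε
  obtain ⟨ψ, hψ⟩ := hφ C Q J π hJ hπ σ
  refine ⟨ψ, fun a _ => ?_⟩
  have ha : π (ψ a) = σ (φ a) := DFunLike.congr_fun hψ a
  simpa [ha] using hε

lemma ProjectiveHom.semiprojectiveHom (hφ : ProjectiveHom φ) : SemiprojectiveHom φ := by
  intro C _ _ J _ _ D _ Q _ ρ π p _ hπ hp σ
  obtain ⟨ψ, hψ⟩ := hφ C Q _ π (isClosed_ker π) (isQuotientBy_ker hπ.surjective) σ
  exact ⟨0, (ρ 0).comp ψ, by rw [← hψ, ← hp 0]; rfl⟩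

lemma WeaklyProjectiveHom.weaklySemiprojectiveHom (hφ : WeaklyProjectiveHom φ) :
    WeaklySemiprojectiveHom φ := by
  intro C _ _ J _ _ D _ Q _ ρ π p _ hπ hp σ ε F hε
  obtain ⟨ψ, hψ⟩ := hφ C Q _ π (isClosed_ker π) (isQuotientBy_ker hπ.surjective) σ ε F hε
  refine ⟨0, (ρ 0).comp ψ, fun a ha => ?_⟩
  have hρ : p 0 (ρ 0 (ψ a)) = π (ψ a) := DFunLike.congr_fun (hp 0) _
  rw [NonUnitalStarAlgHom.comp_apply, hρ]
  exact hψ a ha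

lemma SemiprojectiveHom.weaklySemiprojectiveHom (hφ : SemiprojectiveHom φ) :
    WeaklySemiprojectiveHom φ := by
  intro C _ _ J hJ hmono D _ Q _ ρ π p hρ hπ hp σ ε F hε
  obtain ⟨k, ψ, hψ⟩ := hφ C J hJ hmono D Q ρ π p hρ hπ hp σ
  refine ⟨k, ψ, fun a _ => ?_⟩
  have ha : p k (ψ a) = σ (φ a) := DFunLike.congr_fun hψ a
  simpa [ha] using hε

lemma WeaklyProjectiveHom.exists_seq_tendsto {C Q : Type u}
    [NonUnitalCStarAlgebra C] [NonUnitalCStarAlgebra Q] [TopologicalSpace.SeparableSpace A]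
    [TopologicalSpace.SeparableSpace C] (hφ : WeaklyProjectiveHom φ) {π : C →⋆ₙₐ[ℂ] Q}
    (hπ : Function.Surjective π) (σ : B →⋆ₙₐ[ℂ] Q) :
    ∃ ψ : ℕ → (A →⋆ₙₐ[ℂ] C), ∀ a, Tendsto (fun n => ‖σ (φ a) - π (ψ n a)‖) atTop (𝓝 0) := by
  classical
  obtain ⟨d, hd⟩ := TopologicalSpace.exists_dense_seq A
  choose ψ hψ using fun n : ℕ => hφ C Q (TwoSidedIdeal.ker π) π (isClosed_ker π)
    (isQuotientBy_ker hπ) σ (1 / ((n : ℝ) + 1)) ((Finset.range n).image d) (by positivity)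
  let E := asymptoticEqualizer (prodHom fun _ : ℕ => σ.comp φ) (prodHom fun n => π.comp (ψ n))
  have hdE : Set.range d ⊆ E := by
    rintro _ ⟨i, rfl⟩
    refine mem_nullSequences_of_eventually_le ?_
    filter_upwards [eventually_gt_atTop i] with n hn
    change ‖σ (φ (d i)) - π (ψ n (d i))‖ ≤ 1 / ((n : ℝ) + 1)
    rw [norm_sub_rev]
    exact (hψ n (d i) (Finset.mem_image_of_mem d (Finset.mem_range.2 hn))).le
  exact ⟨ψ, fun a => mem_nullSequences.1
    (closure_minimal hdE (isClosed_asymptoticEqualizer _ _) (hd a))⟩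

theorem IsWeaklyProjective.isProjective [TopologicalSpace.SeparableSpace A]
    (hA : IsWeaklyProjective A) (hA' : IsSemiprojective A) : IsProjective A := by
  intro C Q _ _ _ J π _ hπ σ
  obtain ⟨ψ, hψ⟩ := WeaklyProjectiveHom.exists_seq_tendsto hA hπ.surjective σ
  obtain ⟨-, χ, hχ⟩ := SemiprojectiveHom.exists_lift_of_tendsto hA' (fun _ => hπ.surjective) hψ
  exact ⟨χ, hχ⟩

end Implications

section Averages

variable {C : Type*} [NonUnitalCStarAlgebra C] {y : ℕ → C} {M η : ℝ}

lemma norm_sum_range_sq_le (hM : ∀ i, ‖y i‖ ≤ M) (hη : ∀ i j, i < j → ‖star (y i) * y j‖ ≤ η)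
    (hη₀ : 0 ≤ η) (n : ℕ) : ‖∑ i ∈ Finset.range n, y i‖ ^ 2 ≤ n * M ^ 2 + n ^ 2 * η := by
  have norm_star_mul_le (i j : ℕ) : ‖star (y i) * y j‖ ≤ (if i = j then M ^ 2 else 0) + η := by
    rcases lt_trichotomy i j with h | rfl | h
    · simpa [h.ne] using hη i j h
    · rw [if_pos rfl, CStarRing.norm_star_mul_self]
      nlinarith [norm_nonneg (y i), hM i]
    · rw [if_neg h.ne', zero_add, ← norm_star, star_mul, star_star]
      exact hη j i h
  have sum_row (i : ℕ) (hi : i ∈ Finset.range n) :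
      ∑ j ∈ Finset.range n, ((if i = j then M ^ 2 else 0) + η) = M ^ 2 + n * η := by
    simp [Finset.sum_add_distrib, Finset.sum_ite_eq, Finset.mem_range.1 hi]
  rw [sq, ← CStarRing.norm_star_mul_self, star_sum, Finset.sum_mul_sum]
  calc ‖∑ i ∈ Finset.range n, ∑ j ∈ Finset.range n, star (y i) * y j‖
      ≤ ∑ i ∈ Finset.range n, ∑ j ∈ Finset.range n, ((if i = j then M ^ 2 else 0) + η) :=
        norm_sum_le_of_le _ fun i _ => norm_sum_le_of_le _ fun j _ => norm_star_mul_le i j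
    _ = ∑ _i ∈ Finset.range n, (M ^ 2 + n * η) := Finset.sum_congr rfl sum_row
    _ = n * M ^ 2 + n ^ 2 * η := by
        rw [Finset.sum_const, Finset.card_range, nsmul_eq_mul]
        ring

lemma eventually_norm_average_lt (hM : ∀ i, ‖y i‖ ≤ M)
    (hη : ∀ i j, i < j → ‖star (y i) * y j‖ ≤ η) (hη₀ : 0 ≤ η) {ε : ℝ} (hε : 0 < ε)
    (hηε : η < ε ^ 2) :
    ∀ᶠ n : ℕ in atTop, ‖(n : ℝ)⁻¹ • ∑ i ∈ Finset.range n, y i‖ < ε := by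
  have tendsto_bound : Tendsto (fun n : ℕ => (n : ℝ)⁻¹ * M ^ 2 + η) atTop (𝓝 η) := by
    simpa using (tendsto_inv_atTop_nhds_zero_nat (𝕜 := ℝ)).mul_const (M ^ 2) |>.add_const η
  filter_upwards [tendsto_bound.eventually (gt_mem_nhds hηε), eventually_gt_atTop 0] with n hn hn₀
  have : (0 : ℝ) < n := Nat.cast_pos.2 hn₀
  refine lt_of_pow_lt_pow_left₀ 2 hε.le (lt_of_le_of_lt ?_ hn)
  calc ‖(n : ℝ)⁻¹ • ∑ i ∈ Finset.range n, y i‖ ^ 2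
      = (n : ℝ)⁻¹ ^ 2 * ‖∑ i ∈ Finset.range n, y i‖ ^ 2 := by
        rw [norm_smul, mul_pow, Real.norm_of_nonneg (by positivity)]
    _ ≤ (n : ℝ)⁻¹ ^ 2 * (n * M ^ 2 + n ^ 2 * η) := by
        gcongr
        exact norm_sum_range_sq_le hM hη hη₀ n
    _ = (n : ℝ)⁻¹ * M ^ 2 + η := by field_simp

end Averages

section ConstantSequences

/-- The constant sequences in the bounded product. -/
noncomputable def constHom (C : Type*) [NonUnitalCStarAlgebra C] :
    C →⋆ₙₐ[ℂ] lp (fun _ : ℕ => C) ∞ :=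
  prodHom fun _ => NonUnitalStarAlgHom.id ℂ C

variable {C : Type*} [NonUnitalCStarAlgebra C]

@[simp] lemma constHom_apply (c : C) (n : ℕ) : (constHom C c : ℕ → C) n = c := rfl

lemma continuous_constHom : Continuous (constHom C) := map_continuous _

lemma isClosed_setOf_mul_constHom_sub_mem (u : lp (fun _ : ℕ => C) ∞) :
    IsClosed {c | u * constHom C c - constHom C c ∈ nullSequences fun _ => C} :=
  isClosed_nullSequences.preimage
    ((continuous_const.mul continuous_constHom).sub continuous_constHom)

lemma isClosed_setOf_commutator_mem (u : lp (fun _ : ℕ => C) ∞) :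
    IsClosed {c | u * constHom C c - constHom C c * u ∈ nullSequences fun _ => C} :=
  isClosed_nullSequences.preimage
    ((continuous_const.mul continuous_constHom).sub (continuous_constHom.mul continuous_const))

end ConstantSequences

section Quasicentral

lemma exists_approximate_unit {J : Type*} [NonUnitalCStarAlgebra J] (F : Finset J) {ε : ℝ}
    (hε : 0 < ε) : ∃ b : J, ‖star b * b‖ ≤ 1 ∧
      ∀ j ∈ F, ‖star b * b * j - j‖ < ε ∧ ‖j * (star b * b) - j‖ < ε := by
  let _ := CStarAlgebra.spectralOrder J
  let _ := CStarAlgebra.spectralOrderedRing J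
  have unit := CStarAlgebra.increasingApproximateUnit J
  have eventually_close : ∀ᶠ e in CStarAlgebra.approximateUnit J,
      ∀ j ∈ F, ‖e * j - j‖ < ε ∧ ‖j * e - j‖ < ε := by
    refine (Finset.eventually_all F).2 fun j _ => ?_
    simp only [← dist_eq_norm]
    exact (Metric.tendsto_nhds.1 (unit.tendsto_mul_right j) ε hε).and
      (Metric.tendsto_nhds.1 (unit.tendsto_mul_left j) ε hε)
  obtain ⟨e, he, he₀, he₁⟩ :=
    (eventually_close.and (unit.eventually_nonneg.and unit.eventually_norm)).exists
  obtain ⟨b, rfl⟩ := CStarAlgebra.nonneg_iff_eq_star_mul_self.1 he₀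
  exact ⟨b, he₁, he⟩

variable {C Q : Type*} [CStarAlgebra C] [PartialOrder C] [StarOrderedRing C]
  [NonUnitalCStarAlgebra Q]

/-- The positive contractions in the kernel of `π` that act on `F` from the left as a unit up to
`ε`. -/
def leftApproximateUnits (π : C →⋆ₙₐ[ℂ] Q) (F : Finset C) (ε : ℝ) : Set C :=
  Set.Icc 0 1 ∩ {e | π e = 0} ∩ {e | ∀ j ∈ F, ‖e * j - j‖ < ε}

lemma convex_leftApproximateUnits (π : C →⋆ₙₐ[ℂ] Q) (F : Finset C) (ε : ℝ) :
    Convex ℝ (leftApproximateUnits π F ε) := by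
  refine ((convex_Icc 0 1).inter ?_).inter ?_
  · exact ((LinearMap.ker (π : C →ₗ[ℂ] Q)).restrictScalars ℝ).convex
  · have : {e : C | ∀ j ∈ F, ‖e * j - j‖ < ε} =
        ⋂ j ∈ F, LinearMap.mulRight ℝ j ⁻¹' Metric.ball j ε := by
      ext e
      simp [dist_eq_norm]
    rw [this]
    exact convex_iInter₂ fun j _ => (convex_ball j ε).linear_preimage _

lemma norm_le_one_of_mem_leftApproximateUnits {π : C →⋆ₙₐ[ℂ] Q} {F : Finset C} {ε : ℝ} {e : C}
    (he : e ∈ leftApproximateUnits π F ε) : ‖e‖ ≤ 1 :=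
  (CStarAlgebra.norm_le_one_iff_of_nonneg e he.1.1.1).2 he.1.1.2

lemma exists_mem_leftApproximateUnits (π : C →⋆ₙₐ[ℂ] Q) (F G : Finset C)
    (hF : ∀ j ∈ F, π j = 0) (hG : ∀ j ∈ G, π j = 0) {ε δ : ℝ} (hε : 0 < ε) (hδ : 0 < δ) :
    ∃ e ∈ leftApproximateUnits π F ε, ∀ j ∈ G, ‖j * e - j‖ < δ := by
  classical
  let J := NonUnitalStarAlgHom.equalizer π 0
  have : IsClosed (J : Set C) := isClosed_eq (map_continuous π) continuous_const
  have mem_J (j : C) (hj : j ∈ F ∪ G) : j ∈ J := (Finset.mem_union.1 hj).elim (hF j) (hG j)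
  obtain ⟨b, hb, hunit⟩ := exists_approximate_unit
    ((F ∪ G).attach.image fun j : {j // j ∈ F ∪ G} => (⟨j, mem_J j j.2⟩ : J)) (lt_min hε hδ)
  have hunit' (j : C) (hj : j ∈ F ∪ G) := hunit ⟨j, mem_J j hj⟩
    (Finset.mem_image.2 ⟨⟨j, hj⟩, Finset.mem_attach _ _, rfl⟩)
  have hb₀ : π b = 0 := b.2
  have nonneg : (0 : C) ≤ star (b : C) * b := star_mul_self_nonneg _
  refine ⟨star (b : C) * b,
    ⟨⟨⟨nonneg, (CStarAlgebra.norm_le_one_iff_of_nonneg _ nonneg).1 hb⟩, ?_⟩, fun j hj => ?_⟩,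
    fun j hj => ?_⟩
  · simp [hb₀]
  · exact (hunit' j (Finset.mem_union_left _ hj)).1.trans_le (min_le_left _ _)
  · exact (hunit' j (Finset.mem_union_right _ hj)).2.trans_le (min_le_right _ _)

lemma norm_commutator_le {A : Type*} [NonUnitalNormedRing A] {e : A} (he : ‖e‖ ≤ 1) (c : A) :
    ‖e * c - c * e‖ ≤ 2 * ‖c‖ :=
  calc ‖e * c - c * e‖ ≤ ‖e‖ * ‖c‖ + ‖c‖ * ‖e‖ :=
        (norm_sub_le _ _).trans (add_le_add (norm_mul_le _ _) (norm_mul_le _ _))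
    _ ≤ 2 * ‖c‖ := by nlinarith [norm_nonneg c]

lemma norm_mul_commutator_le {A : Type*} [NonUnitalNormedRing A] (y e c : A) :
    ‖y * (e * c - c * e)‖ ≤ ‖y * e - y‖ * ‖c‖ + ‖y * c * e - y * c‖ :=
  calc ‖y * (e * c - c * e)‖ = ‖(y * e - y) * c - (y * c * e - y * c)‖ := by
        congr 1
        noncomm_ring
    _ ≤ ‖y * e - y‖ * ‖c‖ + ‖y * c * e - y * c‖ :=
        (norm_sub_le _ _).trans (add_le_add (norm_mul_le _ _) le_rfl)

lemma exists_almost_orthogonal_commutators (π : C →⋆ₙₐ[ℂ] Q) (F S s : Finset C)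
    (hF : ∀ j ∈ F, π j = 0) (hs : ∀ e ∈ s, π e = 0) {ε η : ℝ} (hε : 0 < ε) (hη : 0 < η) :
    ∃ e' ∈ leftApproximateUnits π F ε, ∀ e ∈ s, ∀ c ∈ S,
      ‖star (e * c - c * e) * (e' * c - c * e')‖ ≤ η := by
  classical
  obtain ⟨M, hM₀, hM⟩ := S.finite_toSet.isBounded.exists_pos_norm_le
  let Y := (s ×ˢ S).image fun p => star (p.1 * p.2 - p.2 * p.1)
  let Z := (s ×ˢ S).image fun p => star (p.1 * p.2 - p.2 * p.1) * p.2
  have mem_ker (j : C) (hj : j ∈ Y ∪ Z) : π j = 0 := by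
    rcases Finset.mem_union.1 hj with hj | hj <;> obtain ⟨p, hp, rfl⟩ := Finset.mem_image.1 hj <;>
      simp [map_star, hs _ (Finset.mem_product.1 hp).1]
  obtain ⟨e', he', hunit⟩ := exists_mem_leftApproximateUnits π F (Y ∪ Z) hF mem_ker hε
    (show 0 < η / (M + 1) by positivity)
  refine ⟨e', he', fun e he c hc => ?_⟩
  have mem_pair : (e, c) ∈ s ×ˢ S := Finset.mem_product.2 ⟨he, hc⟩
  calc ‖star (e * c - c * e) * (e' * c - c * e')‖
      ≤ η / (M + 1) * M + η / (M + 1) := by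
        refine (norm_mul_commutator_le _ _ _).trans ?_
        gcongr
        · exact (hunit _ (Finset.mem_union_left _ (Finset.mem_image_of_mem _ mem_pair))).le
        · exact hM c hc
        · exact (hunit _ (Finset.mem_union_right _ (Finset.mem_image_of_mem _ mem_pair))).le
    _ = η := by field_simp

lemma exists_quasicentral (π : C →⋆ₙₐ[ℂ] Q) (F S : Finset C) (hF : ∀ j ∈ F, π j = 0) {ε : ℝ}
    (hε : 0 < ε) : ∃ u ∈ leftApproximateUnits π F ε, ∀ c ∈ S, ‖u * c - c * u‖ < ε := by
  obtain ⟨e, he, horth⟩ := exists_seq_of_forall_finset_exists (· ∈ leftApproximateUnits π F ε)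
    (fun e e' => ∀ c ∈ S, ‖star (e * c - c * e) * (e' * c - c * e')‖ ≤ ε ^ 2 / 2)
    fun s hs => exists_almost_orthogonal_commutators π F S s hF (fun e he => (hs e he).1.2) hε
      (by positivity)
  have commutator_average (n : ℕ) (c : C) :
      ((n : ℝ)⁻¹ • ∑ i ∈ Finset.range n, e i) * c - c * ((n : ℝ)⁻¹ • ∑ i ∈ Finset.range n, e i) =
        (n : ℝ)⁻¹ • ∑ i ∈ Finset.range n, (e i * c - c * e i) := by
    rw [Finset.sum_sub_distrib, smul_sub, smul_mul_assoc, Finset.sum_mul, mul_smul_comm,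
      Finset.mul_sum]
  have eventually_small : ∀ᶠ n : ℕ in atTop, ∀ c ∈ S,
      ‖(n : ℝ)⁻¹ • ∑ i ∈ Finset.range n, (e i * c - c * e i)‖ < ε :=
    (Finset.eventually_all S).2 fun c hc => eventually_norm_average_lt
      (fun i => norm_commutator_le (norm_le_one_of_mem_leftApproximateUnits (he i)) c)
      (fun i j hij => horth i j hij c hc) (by positivity) hε (by linarith [pow_pos hε 2])
  obtain ⟨n, hn, hn₀⟩ := (eventually_small.and (eventually_gt_atTop 0)).exists
  refine ⟨(n : ℝ)⁻¹ • ∑ i ∈ Finset.range n, e i, ?_, fun c hc => ?_⟩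
  · rw [Finset.smul_sum]
    refine (convex_leftApproximateUnits π F ε).sum_mem (fun _ _ => by positivity) ?_
      fun i _ => he i
    simp [hn₀.ne']
  · rw [commutator_average]
    exact hn c hc

lemma exists_quasicentral_seq [TopologicalSpace.SeparableSpace C] (π : C →⋆ₙₐ[ℂ] Q) :
    ∃ u : lp (fun _ : ℕ => C) ∞, (∀ n, u n ∈ Set.Icc 0 1) ∧ (∀ n, π (u n) = 0) ∧
      (∀ j, π j = 0 → u * constHom C j - constHom C j ∈ nullSequences fun _ => C) ∧
      ∀ c, u * constHom C c - constHom C c * u ∈ nullSequences fun _ => C := by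
  classical
  obtain ⟨c, hc⟩ := TopologicalSpace.exists_dense_seq C
  have : Nonempty {j : C // π j = 0} := ⟨0, map_zero π⟩
  obtain ⟨j, hj⟩ := TopologicalSpace.exists_dense_seq {j : C // π j = 0}
  choose u hu hcomm using fun n : ℕ => exists_quasicentral π
    ((Finset.range n).image fun i => (j i : C)) ((Finset.range n).image c)
    (fun x hx => by obtain ⟨i, -, rfl⟩ := Finset.mem_image.1 hx; exact (j i).2)
    (show 0 < 1 / ((n : ℝ) + 1) by positivity)
  obtain ⟨U, hU⟩ : ∃ U : lp (fun _ : ℕ => C) ∞, ∀ n, U n = u n :=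
    ⟨⟨u, memℓp_infty ⟨1, Set.forall_mem_range.2 fun n =>
      norm_le_one_of_mem_leftApproximateUnits (hu n)⟩⟩, fun _ => rfl⟩
  simp only [← hU] at hu hcomm
  have approximate_unit (i : ℕ) :
      U * constHom C (j i) - constHom C (j i) ∈ nullSequences fun _ => C := by
    refine mem_nullSequences_of_eventually_le ?_
    filter_upwards [eventually_gt_atTop i] with n hn
    exact ((hu n).2 _ (Finset.mem_image.2 ⟨i, Finset.mem_range.2 hn, rfl⟩)).le
  have quasicentral (i : ℕ) :
      U * constHom C (c i) - constHom C (c i) * U ∈ nullSequences fun _ => C := by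
    refine mem_nullSequences_of_eventually_le ?_
    filter_upwards [eventually_gt_atTop i] with n hn
    exact (hcomm n _ (Finset.mem_image.2 ⟨i, Finset.mem_range.2 hn, rfl⟩)).le
  exact ⟨U, fun n => (hu n).1.1, fun n => (hu n).1.2,
    fun x hx => hj.induction_on (p := fun j => U * constHom C j - constHom C j ∈ _) ⟨x, hx⟩
      ((isClosed_setOf_mul_constHom_sub_mem U).preimage continuous_subtype_val) approximate_unit,
    fun x => hc.induction_on x (isClosed_setOf_commutator_mem U) quasicentral⟩

end Quasicentral

section UnitCalculus

/-- The inclusion of the unit interval into `ℂ`. -/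
def unitIntervalCoe : C(unitInterval, ℂ) := ⟨fun t => ((t : ℝ) : ℂ), by fun_prop⟩

@[simp] lemma unitIntervalCoe_apply (t : unitInterval) : unitIntervalCoe t = ((t : ℝ) : ℂ) := rfl

lemma subalgebra_eq_top_of_unitIntervalCoe_mem {S : Subalgebra ℂ C(unitInterval, ℂ)}
    (hS : IsClosed (S : Set C(unitInterval, ℂ))) (mem : unitIntervalCoe ∈ S) : S = ⊤ := by
  have bernstein_term (n : ℕ) (f : C(unitInterval, ℂ)) (k : Fin (n + 1)) :
      bernstein n k • .const _ (f (bernstein.z k)) =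
        (n.choose k * f (bernstein.z k)) •
          (unitIntervalCoe ^ (k : ℕ) * (1 - unitIntervalCoe) ^ (n - k)) := by
    ext t
    simp [bernstein_apply]
    ring
  refine eq_top_iff.2 fun f _ => hS.mem_of_tendsto (bernsteinApproximation_uniform f)
    (.of_forall fun n => S.sum_mem fun k _ => ?_)
  rw [bernstein_term]
  exact S.smul_mem (mul_mem (pow_mem mem _) (pow_mem (sub_mem (one_mem S) mem) _)) _

variable {C : Type*} [CStarAlgebra C]

/-- The functional calculus `f ↦ f(a)` for continuous functions on the unit interval. For `a` not
a positive contraction, the spectrum of `a` is first retracted onto the interval. -/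
noncomputable def unitCalculus (a : C) [IsStarNormal a] : C(unitInterval, ℂ) →⋆ₐ[ℂ] C :=
  (cfcHom (R := ℂ) ‹IsStarNormal a›).comp (ContinuousMap.compStarAlgHom' ℂ ℂ
    ⟨fun x => Set.projIcc 0 1 zero_le_one (x : ℂ).re, by fun_prop⟩)

lemma unitCalculus_unitIntervalCoe [PartialOrder C] [StarOrderedRing C] {a : C} [IsStarNormal a]
    (ha : a ∈ Set.Icc 0 1) : unitCalculus a unitIntervalCoe = a := by
  have spectrum_eq (x : spectrum ℂ a) :
      ((Set.projIcc (0 : ℝ) 1 zero_le_one (x : ℂ).re : ℝ) : ℂ) = x := by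
    have re_eq : ((x : ℂ).re : ℂ) = x := (ha.1.isSelfAdjoint.mem_spectrum_eq_re x.2).symm
    have re_mem : (x : ℂ).re ∈ spectrum ℝ a := by
      rw [← spectrum.algebraMap_mem_iff ℂ]
      exact re_eq.symm ▸ x.2
    have nonneg : 0 ≤ (x : ℂ).re := spectrum_nonneg_of_nonneg ha.1 re_mem
    have le_one : (x : ℂ).re ≤ 1 := (le_abs_self _).trans <|
      (IsometricContinuousFunctionalCalculus.norm_spectrum_le (𝕜 := ℝ) a re_mem).trans
        ((CStarAlgebra.norm_le_one_iff_of_nonneg a ha.1).2 ha.2)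
    rw [Set.projIcc_of_mem zero_le_one ⟨nonneg, le_one⟩, re_eq]
  refine Eq.trans ?_ (cfcHom_id (R := ℂ) ‹IsStarNormal a›)
  exact congrArg (cfcHom (R := ℂ) ‹IsStarNormal a›) (ContinuousMap.ext spectrum_eq)

end UnitCalculus

section Partition

variable {C ι : Type*} [CStarAlgebra C] [Fintype ι]

open scoped InnerProductSpace in
lemma norm_sum_mul_star_sq_le (x y : ι → C) :
    ‖∑ i, y i * star (x i)‖ ^ 2 ≤ ‖∑ i, x i * star (x i)‖ * ‖∑ i, y i * star (y i)‖ := by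
  let _ := CStarAlgebra.spectralOrder C
  let _ := CStarAlgebra.spectralOrderedRing C
  let X : WithCStarModule C (ι → C) := (WithCStarModule.equiv C (ι → C)).symm x
  let Y : WithCStarModule C (ι → C) := (WithCStarModule.equiv C (ι → C)).symm y
  have cauchy_schwarz : ‖⟪X, Y⟫_C‖ ≤ ‖X‖ * ‖Y‖ := CStarModule.norm_inner_le _
  calc ‖∑ i, y i * star (x i)‖ ^ 2 = ‖⟪X, Y⟫_C‖ ^ 2 := rfl
    _ ≤ ‖X‖ ^ 2 * ‖Y‖ ^ 2 := by
        rw [← mul_pow]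
        gcongr
    _ = ‖∑ i, x i * star (x i)‖ * ‖∑ i, y i * star (y i)‖ := by
        rw [WithCStarModule.pi_norm_sq, WithCStarModule.pi_norm_sq]
        rfl

lemma norm_sum_conjugate_le {v k : ι → C} {M : ℝ} (hv : ∑ i, v i * star (v i) = 1)
    (hM : ∀ i, ‖k i‖ ≤ M) (hM₀ : 0 ≤ M) : ‖∑ i, v i * k i * star (v i)‖ ≤ M := by
  let _ := CStarAlgebra.spectralOrder C
  let _ := CStarAlgebra.spectralOrderedRing C
  have le_term (i : ι) : v i * k i * star (v i * k i) ≤ M ^ 2 • (v i * star (v i)) := by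
    have : k i * star (k i) ≤ algebraMap ℝ C (M ^ 2) :=
      CStarAlgebra.mul_star_le_algebraMap_norm_sq.trans
        (algebraMap_mono C (pow_le_pow_left₀ (norm_nonneg _) (hM i) 2))
    simpa [Algebra.algebraMap_eq_smul_one, mul_assoc] using
      star_right_conjugate_le_conjugate this (v i)
  have norm_sum_le : ‖∑ i, v i * k i * star (v i * k i)‖ ≤ M ^ 2 := by
    rw [CStarAlgebra.norm_le_iff_le_algebraMap _ (sq_nonneg M)
      (Finset.sum_nonneg fun i _ => mul_star_self_nonneg _), Algebra.algebraMap_eq_smul_one, ← hv,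
      Finset.smul_sum]
    exact Finset.sum_le_sum fun i _ => le_term i
  refine (pow_le_pow_iff_left₀ (norm_nonneg _) hM₀ two_ne_zero).1 ?_
  calc ‖∑ i, v i * k i * star (v i)‖ ^ 2
      ≤ ‖∑ i, v i * star (v i)‖ * ‖∑ i, v i * k i * star (v i * k i)‖ :=
        norm_sum_mul_star_sq_le v fun i => v i * k i
    _ ≤ 1 * M ^ 2 := by
        rw [hv]
        gcongr
        exact (CStarAlgebra.norm_le_one_iff_of_nonneg (1 : C) zero_le_one).2 le_rfl
    _ = M ^ 2 := one_mul _

end Partition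

section QuasicentralCalculus

variable {C Q : Type*} [CStarAlgebra C] [CStarAlgebra Q]

/-- A functional calculus `Θ f = (f(a₀), f(a₁), …)` where `1 - aₙ` is a quasicentral approximate
unit of the kernel of `π`. Asymptotically, `f ⊗ π c ↦ Θ f * c` is then a morphism from the cone over
`Q` to `C`. -/
structure IsQuasicentralCalculus (π : C →⋆ₐ[ℂ] Q)
    (Θ : C(unitInterval, ℂ) →⋆ₙₐ[ℂ] lp (fun _ : ℕ => C) ∞) : Prop where
  apply_one : ∀ n, Θ 1 n = 1
  map_apply : ∀ f n, π (Θ f n) = algebraMap ℂ Q (f 1)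
  mul_sub_mem : ∀ f j, π j = 0 → Θ f * constHom C j - f 0 • constHom C j ∈ nullSequences fun _ => C
  commutator_mem : ∀ f c, Θ f * constHom C c - constHom C c * Θ f ∈ nullSequences fun _ => C

lemma algHom_ext_unitIntervalCoe {φ ψ : C(unitInterval, ℂ) →ₐ[ℂ] Q} (hφ : Continuous φ)
    (hψ : Continuous ψ) (h : φ unitIntervalCoe = ψ unitIntervalCoe) : φ = ψ :=
  AlgHom.ext fun f => (subalgebra_eq_top_of_unitIntervalCoe_mem
    (S := AlgHom.equalizer φ ψ) (isClosed_eq hφ hψ) h).ge (Algebra.mem_top (x := f))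

variable {Θ : C(unitInterval, ℂ) →⋆ₙₐ[ℂ] lp (fun _ : ℕ => C) ∞}

lemma mul_sub_mem_of_unitIntervalCoe (hΘ : ∀ n, Θ 1 n = 1) {j : C}
    (hj : Θ unitIntervalCoe * constHom C j ∈ nullSequences fun _ => C) (f : C(unitInterval, ℂ)) :
    Θ f * constHom C j - f 0 • constHom C j ∈ nullSequences fun _ => C := by
  let S : Subalgebra ℂ C(unitInterval, ℂ) :=
    { carrier := {f | Θ f * constHom C j - f 0 • constHom C j ∈ nullSequences fun _ => C}
      add_mem' := fun {f g} hf hg => by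
        refine (congrArg (· ∈ nullSequences fun _ => C) ?_).mp (add_mem hf hg)
        rw [map_add, add_mul, ContinuousMap.add_apply, add_smul]
        abel
      mul_mem' := fun {f g} hf hg => by
        refine (congrArg (· ∈ nullSequences fun _ => C) ?_).mp
          (add_mem (TwoSidedIdeal.mul_mem_left _ (Θ f) _ hg) (smul_mem_nullSequences (g 0) hf))
        rw [map_mul, ContinuousMap.mul_apply, mul_sub, smul_sub, mul_smul_comm, smul_smul,
          mul_comm (g 0) (f 0), mul_assoc]
        abel
      algebraMap_mem' := fun r => by
        have : Θ (algebraMap ℂ _ r) * constHom C j = r • constHom C j := by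
          rw [Algebra.algebraMap_eq_smul_one, map_smul, smul_mul_assoc]
          congr 1
          ext n
          simp [hΘ]
        simp [this, zero_mem] }
  have continuous_smul : Continuous fun f : C(unitInterval, ℂ) => f 0 • constHom C j := by
    fun_prop
  have coe_mem : unitIntervalCoe ∈ S := by
    change Θ unitIntervalCoe * _ - unitIntervalCoe 0 • _ ∈ nullSequences _
    simpa using hj
  have hS : S = ⊤ := subalgebra_eq_top_of_unitIntervalCoe_mem
    (isClosed_nullSequences.preimage
      (((map_continuous Θ).mul continuous_const).sub continuous_smul)) coe_mem
  exact hS.ge (Algebra.mem_top (x := f))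

lemma commutator_mem_of_unitIntervalCoe (hΘ : ∀ n, Θ 1 n = 1) {c : C}
    (hc : Θ unitIntervalCoe * constHom C c - constHom C c * Θ unitIntervalCoe ∈
      nullSequences fun _ => C) (f : C(unitInterval, ℂ)) :
    Θ f * constHom C c - constHom C c * Θ f ∈ nullSequences fun _ => C := by
  let S : Subalgebra ℂ C(unitInterval, ℂ) :=
    { carrier := {f | Θ f * constHom C c - constHom C c * Θ f ∈ nullSequences fun _ => C}
      add_mem' := fun {f g} hf hg => by
        refine (congrArg (· ∈ nullSequences fun _ => C) ?_).mp (add_mem hf hg)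
        rw [map_add, add_mul, mul_add]
        abel
      mul_mem' := fun {f g} hf hg => by
        refine (congrArg (· ∈ nullSequences fun _ => C) ?_).mp
          (add_mem (TwoSidedIdeal.mul_mem_left _ (Θ f) _ hg)
            (TwoSidedIdeal.mul_mem_right _ _ (Θ g) hf))
        rw [map_mul]
        noncomm_ring
      algebraMap_mem' := fun r => by
        have : Θ (algebraMap ℂ _ r) * constHom C c = constHom C c * Θ (algebraMap ℂ _ r) := by
          rw [Algebra.algebraMap_eq_smul_one, map_smul, smul_mul_assoc, mul_smul_comm]
          congr 1
          ext n
          simp [hΘ]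
        simp [this, zero_mem] }
  have hS : S = ⊤ := subalgebra_eq_top_of_unitIntervalCoe_mem
    (isClosed_nullSequences.preimage (((map_continuous Θ).mul continuous_const).sub
      (continuous_const.mul (map_continuous Θ)))) hc
  exact hS.ge (Algebra.mem_top (x := f))

lemma exists_isQuasicentralCalculus [TopologicalSpace.SeparableSpace C] (π : C →⋆ₐ[ℂ] Q) :
    ∃ Θ, IsQuasicentralCalculus π Θ := by
  let _ := CStarAlgebra.spectralOrder C
  let _ := CStarAlgebra.spectralOrderedRing C
  obtain ⟨u, hu, hπu, hunit, hcomm⟩ := exists_quasicentral_seq (π : C →⋆ₙₐ[ℂ] Q)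
  have mem_Icc (n : ℕ) : 1 - u n ∈ Set.Icc 0 1 :=
    ⟨sub_nonneg.2 (hu n).2, sub_le_self 1 (hu n).1⟩
  have (n : ℕ) : IsStarNormal (1 - u n) := (mem_Icc n).1.isSelfAdjoint.isStarNormal
  let Θ : C(unitInterval, ℂ) →⋆ₙₐ[ℂ] lp (fun _ : ℕ => C) ∞ :=
    prodHom fun n => (unitCalculus (1 - u n) : C(unitInterval, ℂ) →⋆ₙₐ[ℂ] C)
  have apply_one (n : ℕ) : Θ 1 n = 1 := map_one (unitCalculus (1 - u n))
  have apply_coe (n : ℕ) : Θ unitIntervalCoe n = 1 - u n :=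
    unitCalculus_unitIntervalCoe (mem_Icc n)
  have coe_mul (c : C) : Θ unitIntervalCoe * constHom C c = constHom C c - u * constHom C c := by
    ext n
    simp only [lp.infty_coeFn_mul, lp.coeFn_sub, Pi.mul_apply, Pi.sub_apply, constHom_apply,
      apply_coe, sub_mul, one_mul]
  have mul_coe (c : C) : constHom C c * Θ unitIntervalCoe = constHom C c - constHom C c * u := by
    ext n
    simp only [lp.infty_coeFn_mul, lp.coeFn_sub, Pi.mul_apply, Pi.sub_apply, constHom_apply,
      apply_coe, mul_sub, mul_one]
  refine ⟨Θ, apply_one, fun f n => ?_,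
    fun f j hj => mul_sub_mem_of_unitIntervalCoe apply_one ?_ f,
    fun f c => commutator_mem_of_unitIntervalCoe apply_one ?_ f⟩
  · have : ((π.comp (unitCalculus (1 - u n)) : C(unitInterval, ℂ) →⋆ₐ[ℂ] Q) :
        C(unitInterval, ℂ) →ₐ[ℂ] Q) =
        (Algebra.ofId ℂ Q).comp (ContinuousMap.evalAlgHom ℂ ℂ 1) := by
      refine algHom_ext_unitIntervalCoe
        (map_continuous (π.comp (unitCalculus (1 - u n)) : C(unitInterval, ℂ) →⋆ₐ[ℂ] Q))
        ((continuous_algebraMap ℂ Q).comp (continuous_eval_const 1)) ?_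
      change π (unitCalculus (1 - u n) unitIntervalCoe) = algebraMap ℂ Q (unitIntervalCoe 1)
      have map_eq_zero : π (u n) = 0 := hπu n
      simp [unitCalculus_unitIntervalCoe (mem_Icc n), map_eq_zero]
    exact DFunLike.congr_fun this f
  · rw [coe_mul, ← neg_sub]
    exact neg_mem (hunit j hj)
  · rw [coe_mul, mul_coe, sub_sub_sub_cancel_left, ← neg_sub]
    exact neg_mem (hcomm c)

end QuasicentralCalculus

section SqrtBernstein

/-- The square root of a Bernstein polynomial. The squares of these functions form a partition of
unity on the unit interval. -/
noncomputable def sqrtBernstein (m : ℕ) (k : Fin (m + 1)) : C(unitInterval, ℂ) :=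
  ⟨fun t => (√(bernstein m k t) : ℝ), by fun_prop⟩

lemma sqrtBernstein_mul_self_apply (m : ℕ) (k : Fin (m + 1)) (t : unitInterval) :
    (sqrtBernstein m k * sqrtBernstein m k) t = (bernstein m k t : ℂ) := by
  change ((√(bernstein m k t) : ℝ) : ℂ) * ((√(bernstein m k t) : ℝ) : ℂ) = _
  rw [← Complex.ofReal_mul, Real.mul_self_sqrt bernstein_nonneg]

lemma star_sqrtBernstein (m : ℕ) (k : Fin (m + 1)) : star (sqrtBernstein m k) = sqrtBernstein m k :=
  ContinuousMap.ext fun _ => Complex.conj_ofReal _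

lemma sum_sqrtBernstein_mul_self (m : ℕ) :
    ∑ k : Fin (m + 1), sqrtBernstein m k * sqrtBernstein m k = 1 := by
  ext t
  simp only [ContinuousMap.sum_apply, sqrtBernstein_mul_self_apply, ContinuousMap.one_apply]
  exact_mod_cast bernstein.probability m t

lemma sqrtBernstein_mul_self_apply_zero {m : ℕ} {k : Fin (m + 1)} (hk : k ≠ 0) :
    (sqrtBernstein m k * sqrtBernstein m k) 0 = 0 := by
  have : (k : ℕ) ≠ 0 := fun h => hk (Fin.ext h)
  rw [sqrtBernstein_mul_self_apply, bernstein_apply]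
  simp [this]

lemma bernsteinApproximation_eq_sum (m : ℕ) {E : Type*} [NormedAddCommGroup E] [NormedSpace ℂ E]
    (f : C(unitInterval, E)) : bernsteinApproximation m f = ∑ k : Fin (m + 1),
      (sqrtBernstein m k * sqrtBernstein m k) • ContinuousMap.const _ (f (bernstein.z k)) := by
  ext t
  rw [bernsteinApproximation.apply, ContinuousMap.sum_apply]
  refine Finset.sum_congr rfl fun k _ => ?_
  rw [ContinuousMap.smul_apply', sqrtBernstein_mul_self_apply, ContinuousMap.const_apply,
    Complex.coe_smul]

end SqrtBernstein

section BernsteinSum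

variable {C Q : Type*} [CStarAlgebra C] [CStarAlgebra Q] {π : C →⋆ₐ[ℂ] Q}
  {Θ : C(unitInterval, ℂ) →⋆ₙₐ[ℂ] lp (fun _ : ℕ => C) ∞}

/-- The sequence `∑ₖ bₖ(aₙ) cₖ`, where `bₖ` are the Bernstein polynomials of degree `m` and `Θ` is
the functional calculus of the sequence `(aₙ)`. -/
noncomputable def bernsteinSum (Θ : C(unitInterval, ℂ) →⋆ₙₐ[ℂ] lp (fun _ : ℕ => C) ∞) (m : ℕ) :
    (Fin (m + 1) → C) →ₗ[ℂ] lp (fun _ : ℕ => C) ∞ where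
  toFun c := ∑ k, Θ (sqrtBernstein m k * sqrtBernstein m k) * constHom C (c k)
  map_add' c d := by simp only [Pi.add_apply, map_add, mul_add, Finset.sum_add_distrib]
  map_smul' r c := by
    simp only [Pi.smul_apply, map_smul, mul_smul_comm, Finset.smul_sum, RingHom.id_apply]

lemma bernsteinSum_apply (m : ℕ) (c : Fin (m + 1) → C) :
    bernsteinSum Θ m c = ∑ k, Θ (sqrtBernstein m k * sqrtBernstein m k) * constHom C (c k) := rfl

lemma bernsteinSum_smul_const (m : ℕ) (f : C(unitInterval, ℂ)) (c : C) :
    bernsteinSum Θ m (fun k => f (bernstein.z k) • c) =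
      Θ (bernsteinApproximation m f) * constHom C c := by
  rw [bernsteinSum_apply, bernsteinApproximation_eq_sum, map_sum, Finset.sum_mul]
  refine Finset.sum_congr rfl fun k _ => ?_
  have smul_const : (sqrtBernstein m k * sqrtBernstein m k) •
      ContinuousMap.const unitInterval (f (bernstein.z k)) =
      f (bernstein.z k) • (sqrtBernstein m k * sqrtBernstein m k) := by
    ext t
    exact mul_comm _ _
  rw [smul_const, map_smul, map_smul, mul_smul_comm, smul_mul_assoc]

lemma tendsto_bernsteinSum_smul_const (f : C(unitInterval, ℂ)) (c : C) :
    Tendsto (fun m => bernsteinSum Θ m fun k => f (bernstein.z k) • c) atTop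
      (𝓝 (Θ f * constHom C c)) := by
  simp only [bernsteinSum_smul_const]
  exact (((map_continuous Θ).tendsto f).comp (bernsteinApproximation_uniform f)).mul_const _

lemma IsQuasicentralCalculus.bernsteinSum_mem_nullSequences (hΘ : IsQuasicentralCalculus π Θ)
    {m : ℕ} {d : Fin (m + 1) → C} (hd : ∀ k, π (d k) = 0) (hd₀ : d 0 = 0) :
    bernsteinSum Θ m d ∈ nullSequences fun _ => C := by
  rw [bernsteinSum_apply]
  refine sum_mem fun k _ => ?_
  rcases eq_or_ne k 0 with rfl | hk
  · rw [hd₀, map_zero, mul_zero]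
    exact zero_mem _
  · simpa only [sqrtBernstein_mul_self_apply_zero hk, zero_smul, sub_zero] using
      hΘ.mul_sub_mem (sqrtBernstein m k * sqrtBernstein m k) (d k) (hd k)

lemma IsQuasicentralCalculus.bernsteinSum_sub_sum_conjugate_mem (hΘ : IsQuasicentralCalculus π Θ)
    {m : ℕ} (c : Fin (m + 1) → C) :
    bernsteinSum Θ m c - ∑ k, Θ (sqrtBernstein m k) * constHom C (c k) * Θ (sqrtBernstein m k) ∈
      nullSequences fun _ => C := by
  rw [bernsteinSum_apply, ← Finset.sum_sub_distrib]
  refine sum_mem fun k _ => ?_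
  rw [map_mul, mul_assoc, mul_assoc, ← mul_sub]
  exact TwoSidedIdeal.mul_mem_left _ _ _ (hΘ.commutator_mem _ _)

lemma IsQuasicentralCalculus.norm_sum_conjugate_apply_le (hΘ : IsQuasicentralCalculus π Θ)
    {m : ℕ} {c : Fin (m + 1) → C} {M : ℝ} (hM : ∀ k, ‖c k‖ ≤ M) (n : ℕ) :
    ‖(∑ k, Θ (sqrtBernstein m k) * constHom C (c k) * Θ (sqrtBernstein m k)) n‖ ≤ M := by
  have star_apply (k : Fin (m + 1)) :
      star (Θ (sqrtBernstein m k) n) = Θ (sqrtBernstein m k) n := by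
    conv_rhs => rw [← star_sqrtBernstein, map_star]
    rfl
  have sum_eq_one : ∑ k, Θ (sqrtBernstein m k) n * star (Θ (sqrtBernstein m k) n) = 1 := by
    rw [← hΘ.apply_one n, ← sum_sqrtBernstein_mul_self m, map_sum, lp.coeFn_sum, Finset.sum_apply]
    simp only [star_apply, map_mul, lp.infty_coeFn_mul, Pi.mul_apply]
  have sum_apply : (∑ k, Θ (sqrtBernstein m k) * constHom C (c k) * Θ (sqrtBernstein m k)) n =
      ∑ k, Θ (sqrtBernstein m k) n * c k * star (Θ (sqrtBernstein m k) n) := by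
    simp only [lp.coeFn_sum, Finset.sum_apply, star_apply, lp.infty_coeFn_mul, Pi.mul_apply,
      constHom_apply]
  rw [sum_apply]
  exact norm_sum_conjugate_le sum_eq_one hM ((norm_nonneg _).trans (hM 0))

lemma IsQuasicentralCalculus.eventually_norm_bernsteinSum_le (hΘ : IsQuasicentralCalculus π Θ)
    {m : ℕ} {c : Fin (m + 1) → C} {M : ℝ} (hM : ∀ k, ‖c k‖ ≤ M) {ε : ℝ} (hε : 0 < ε) :
    ∀ᶠ n in atTop, ‖bernsteinSum Θ m c n‖ ≤ M + ε := by
  filter_upwards [eventually_norm_lt_of_mem_nullSequences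
    (hΘ.bernsteinSum_sub_sum_conjugate_mem c) hε] with n hn
  exact (norm_le_norm_add_norm_sub' _ _).trans
    (add_le_add (hΘ.norm_sum_conjugate_apply_le hM n) hn.le)

end BernsteinSum

section Cone

variable {C Q : Type u} [CStarAlgebra C] [CStarAlgebra Q] {π : C →⋆ₐ[ℂ] Q}
  {Θ : C(unitInterval, ℂ) →⋆ₙₐ[ℂ] lp (fun _ : ℕ => C) ∞}

/-- The pairs of a sequence asymptotic to `(f(aₙ) c)` and the elementary tensor `f ⊗ π c` in the
cone over `Q`, such that the sequence lifts the endpoint of the path. -/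
noncomputable def coneTensors (hΘ : IsQuasicentralCalculus π Θ) :
    Subsemigroup (lp (fun _ : ℕ => C) ∞ × C(unitInterval, Q)) where
  carrier := {z | (∃ (f : C(unitInterval, ℂ)) (c : C), f 0 = 0 ∧
    z.1 - Θ f * constHom C c ∈ nullSequences (fun _ => C) ∧ ∀ t, z.2 t = f t • π c) ∧
    ∀ n, π (z.1 n) = z.2 1}
  mul_mem' := by
    rintro x y ⟨⟨f, c, hf, hx, hx'⟩, hπx⟩ ⟨⟨g, d, -, hy, hy'⟩, hπy⟩
    refine ⟨⟨f * g, c * d, by simp [hf], ?_, fun t => ?_⟩, fun n => ?_⟩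
    · refine (congrArg (· ∈ nullSequences fun _ => C) ?_).mp (sub_mem (add_mem
        (TwoSidedIdeal.mul_mem_right _ _ y.1 hx)
        (TwoSidedIdeal.mul_mem_left _ (Θ f * constHom C c) _ hy))
        (TwoSidedIdeal.mul_mem_right _ _ (constHom C d)
          (TwoSidedIdeal.mul_mem_left _ (Θ f) _ (hΘ.commutator_mem g c))))
      rw [Prod.fst_mul, map_mul, map_mul]
      noncomm_ring
    · rw [Prod.snd_mul, ContinuousMap.mul_apply, ContinuousMap.mul_apply, hx', hy', map_mul,
        smul_mul_smul_comm]
    · rw [Prod.fst_mul, Prod.snd_mul, lp.infty_coeFn_mul, Pi.mul_apply, ContinuousMap.mul_apply,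
        map_mul, hπx, hπy]

lemma star_mem_coneTensors (hΘ : IsQuasicentralCalculus π Θ)
    {x : lp (fun _ : ℕ => C) ∞ × C(unitInterval, Q)} (hx : x ∈ coneTensors hΘ) :
    star x ∈ coneTensors hΘ := by
  obtain ⟨⟨f, c, hf, hx, hx'⟩, hπx⟩ := hx
  refine ⟨⟨star f, star c, by simp [hf], ?_, fun t => ?_⟩, fun n => ?_⟩
  · refine (congrArg (· ∈ nullSequences fun _ => C) ?_).mp (sub_mem (star_mem_nullSequences hx)
      (hΘ.commutator_mem (star f) (star c)))
    rw [Prod.fst_star, star_sub, star_mul, map_star, map_star]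
    abel
  · rw [Prod.snd_star, ContinuousMap.star_apply, ContinuousMap.star_apply, hx', star_smul, map_star]
  · rw [Prod.fst_star, Prod.snd_star, lp.star_apply, ContinuousMap.star_apply, map_star, hπx]

/-- The graph of the asymptotic morphism `f ⊗ π c ↦ (f(aₙ) c)` from the cone over `Q` to `C`. -/
noncomputable def coneGraph (hΘ : IsQuasicentralCalculus π Θ) :
    NonUnitalStarSubalgebra ℂ (lp (fun _ : ℕ => C) ∞ × C(unitInterval, Q)) :=
  NonUnitalStarAlgebra.adjoin ℂ (coneTensors hΘ : Set (lp (fun _ : ℕ => C) ∞ × C(unitInterval, Q)))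

lemma mem_coneGraph_iff_mem_span (hΘ : IsQuasicentralCalculus π Θ)
    {z : lp (fun _ : ℕ => C) ∞ × C(unitInterval, Q)} :
    z ∈ coneGraph hΘ ↔ z ∈ Submodule.span ℂ
      (coneTensors hΘ : Set (lp (fun _ : ℕ => C) ∞ × C(unitInterval, Q))) := by
  have closure_eq : Subsemigroup.closure ((coneTensors hΘ : Set _) ∪ star (coneTensors hΘ : Set _))
      = coneTensors hΘ := by
    rw [Set.union_eq_left.2 fun z hz => by simpa using star_mem_coneTensors hΘ hz,
      Subsemigroup.closure_eq]
  have := NonUnitalStarAlgebra.adjoin_eq_span (R := ℂ)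
    (coneTensors hΘ : Set (lp (fun _ : ℕ => C) ∞ × C(unitInterval, Q)))
  rw [closure_eq] at this
  exact SetLike.ext_iff.1 this z

lemma mul_constHom_mem_coneGraph (hΘ : IsQuasicentralCalculus π Θ) {f : C(unitInterval, ℂ)}
    (hf : f 0 = 0) (c : C) :
    (Θ f * constHom C c, f • ContinuousMap.const _ (π c)) ∈ coneGraph hΘ := by
  refine NonUnitalStarAlgebra.subset_adjoin ℂ _ ⟨⟨f, c, hf, ?_, fun t => rfl⟩, fun n => ?_⟩
  · rw [sub_self]
    exact zero_mem _
  · rw [lp.infty_coeFn_mul, Pi.mul_apply, constHom_apply, map_mul, hΘ.map_apply,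
      Algebra.algebraMap_eq_smul_one, smul_mul_assoc, one_mul]
    rfl

lemma map_fst_apply_of_mem_coneGraph (hΘ : IsQuasicentralCalculus π Θ)
    {z : lp (fun _ : ℕ => C) ∞ × C(unitInterval, Q)} (hz : z ∈ coneGraph hΘ) (n : ℕ) :
    π (z.1 n) = z.2 1 := by
  rw [mem_coneGraph_iff_mem_span] at hz
  induction hz using Submodule.span_induction with
  | mem z hz => exact hz.2 n
  | zero => exact map_zero π
  | add x y _ _ hx hy => exact (map_add π _ _).trans (congrArg₂ (· + ·) hx hy)
  | smul r x _ hx => exact (map_smul π _ _).trans (congrArg (r • ·) hx)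

lemma exists_tendsto_bernsteinSum (hΘ : IsQuasicentralCalculus π Θ)
    {z : lp (fun _ : ℕ => C) ∞ × C(unitInterval, Q)} (hz : z ∈ coneGraph hΘ) :
    ∃ h : unitInterval → C, h 0 = 0 ∧ (∀ t, π (h t) = z.2 t) ∧ ∃ y ∈ nullSequences fun _ => C,
      Tendsto (fun m => bernsteinSum Θ m fun k => h (bernstein.z k)) atTop (𝓝 (z.1 - y)) := by
  rw [mem_coneGraph_iff_mem_span] at hz
  induction hz using Submodule.span_induction with
  | mem z hz =>
    obtain ⟨⟨f, c, hf, hz, hz'⟩, -⟩ := hz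
    refine ⟨fun t => f t • c, by simp [hf], fun t => by rw [map_smul, hz'], _, hz, ?_⟩
    rw [sub_sub_cancel]
    exact tendsto_bernsteinSum_smul_const f c
  | zero =>
    refine ⟨0, rfl, fun _ => map_zero π, 0, zero_mem _, ?_⟩
    rw [Prod.fst_zero, sub_zero]
    exact tendsto_const_nhds.congr fun m => (map_zero (bernsteinSum Θ m)).symm
  | add x x' _ _ hx hx' =>
    obtain ⟨h, h_zero, map_h, y, hy, tendsto_h⟩ := hx
    obtain ⟨h', h'_zero, map_h', y', hy', tendsto_h'⟩ := hx'
    refine ⟨h + h', by simp [h_zero, h'_zero], fun t => ?_, y + y', add_mem hy hy', ?_⟩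
    · rw [Pi.add_apply, map_add, map_h, map_h']
      rfl
    · rw [Prod.fst_add, add_sub_add_comm]
      exact (tendsto_h.add tendsto_h').congr fun m => (map_add (bernsteinSum Θ m) _ _).symm
  | smul r x _ hx =>
    obtain ⟨h, h_zero, map_h, y, hy, tendsto_h⟩ := hx
    refine ⟨r • h, by simp [h_zero], fun t => ?_, r • y, smul_mem_nullSequences r hy, ?_⟩
    · rw [Pi.smul_apply, map_smul, map_h]
      rfl
    · rw [Prod.smul_fst, ← smul_sub]
      exact (tendsto_h.const_smul r).congr fun m => (map_smul (bernsteinSum Θ m) r _).symm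

lemma isAsymptoticGraph_coneGraph (hΘ : IsQuasicentralCalculus π Θ) :
    IsAsymptoticGraph (coneGraph hΘ) := by
  refine ⟨2, fun z hz ε hε => ?_⟩
  obtain ⟨h, h_zero, map_h, y, hy, tendsto_h⟩ := exists_tendsto_bernsteinSum hΘ hz
  obtain ⟨m, hm⟩ := ((tendsto_iff_norm_sub_tendsto_zero.1 tendsto_h).eventually
    (gt_mem_nhds (show 0 < ε / 3 by positivity))).exists
  choose d hd norm_sub_le using fun k : Fin (m + 1) =>
    exists_mem_ker_norm_sub_le (π : C →⋆ₙₐ[ℂ] Q) (h (bernstein.z k))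
  have norm_sub_le' (k : Fin (m + 1)) : ‖h (bernstein.z k) - d k‖ ≤ 2 * ‖z.2‖ :=
    (norm_sub_le k).trans (mul_le_mul_of_nonneg_left
      ((congrArg norm (map_h _)).trans_le (z.2.norm_coe_le_norm _)) zero_le_two)
  have d_zero : d 0 = 0 := by simpa [h_zero] using norm_sub_le 0
  filter_upwards [eventually_norm_lt_of_mem_nullSequences
      (add_mem hy (hΘ.bernsteinSum_mem_nullSequences hd d_zero)) (show 0 < ε / 3 by positivity),
    hΘ.eventually_norm_bernsteinSum_le norm_sub_le' (show 0 < ε / 3 by positivity)]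
    with n null_lt sum_le
  have split : z.1 = (y + bernsteinSum Θ m d) +
      bernsteinSum Θ m (fun k => h (bernstein.z k) - d k) -
      (bernsteinSum Θ m (fun k => h (bernstein.z k)) - (z.1 - y)) := by
    rw [show (fun k => h (bernstein.z k) - d k) = (fun k => h (bernstein.z k)) - d from rfl,
      map_sub]
    abel
  have approx_lt := (lp.norm_apply_le_norm ENNReal.top_ne_zero _ n).trans_lt hm
  rw [split, NNReal.coe_ofNat]
  refine (norm_sub_le_of_le (norm_add_le_of_le null_lt.le sum_le) approx_lt.le).trans ?_
  linarith

lemma mem_closure_snd_coneGraph (hΘ : IsQuasicentralCalculus π Θ) (hπ : Function.Surjective π)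
    {p : C(unitInterval, Q)} (hp : p 0 = 0) : p ∈ closure (Prod.snd '' (coneGraph hΘ : Set
      (lp (fun _ : ℕ => C) ∞ × C(unitInterval, Q)))) := by
  refine mem_closure_of_tendsto (bernsteinApproximation_uniform p) (.of_forall fun m => ?_)
  rw [bernsteinApproximation_eq_sum]
  refine sum_mem (S := ((coneGraph hΘ).map (NonUnitalStarAlgHom.snd ℂ _ _))) fun k _ => ?_
  rcases eq_or_ne k 0 with rfl | hk
  · rw [bernstein.z_zero, hp]
    exact ⟨0, zero_mem _, ContinuousMap.ext fun t => (smul_zero _).symm⟩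
  · obtain ⟨c, hc⟩ := hπ (p (bernstein.z k))
    rw [← hc]
    exact ⟨_, mul_constHom_mem_coneGraph hΘ (sqrtBernstein_mul_self_apply_zero hk) c, rfl⟩

end Cone

section Projective

variable {A B C D Q : Type u} [NonUnitalCStarAlgebra A] [NonUnitalCStarAlgebra B]
  [NonUnitalCStarAlgebra D] [TopologicalSpace.SeparableSpace B]

lemma SemiprojectiveHom.exists_lift_path_unital [CStarAlgebra C] [CStarAlgebra Q]
    [TopologicalSpace.SeparableSpace C] {φ : A →⋆ₙₐ[ℂ] B} (hφ : SemiprojectiveHom φ)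
    {π : C →⋆ₐ[ℂ] Q} (hπ : Function.Surjective π) (τ : B →⋆ₙₐ[ℂ] C(unitInterval, Q))
    (hτ : ∀ b, τ b 0 = 0) : ∃ ψ : A →⋆ₙₐ[ℂ] C, ∀ a, π (ψ a) = τ (φ a) 1 := by
  obtain ⟨Θ, hΘ⟩ := exists_isQuasicentralCalculus π
  obtain ⟨-, ψ, hψ⟩ := hφ.exists_lift_of_isAsymptoticGraph (isAsymptoticGraph_coneGraph hΘ) τ
    (fun b => mem_closure_snd_coneGraph hΘ hπ (hτ b)) (fun _ => (π : C →⋆ₙₐ[ℂ] Q))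
    (fun _ => evalHom Q 1) (fun _ hz => map_fst_apply_of_mem_coneGraph hΘ hz)
  exact ⟨ψ, hψ⟩

lemma separableSpace_unitization (C : Type*) [NonUnitalCStarAlgebra C]
    [TopologicalSpace.SeparableSpace C] :
    TopologicalSpace.SeparableSpace (Unitization ℂ C) := by
  have continuous_inr : Continuous fun c : C => (c : Unitization ℂ C) :=
    (Unitization.isometry_inr (𝕜 := ℂ)).continuous
  have surjective : Function.Surjective fun p : ℂ × C =>
      algebraMap ℂ (Unitization ℂ C) p.1 + (p.2 : Unitization ℂ C) :=
    fun x => ⟨(x.fst, x.snd), Unitization.inl_fst_add_inr_snd_eq x⟩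
  exact surjective.denseRange.separableSpace
    (((algebraMapCLM ℂ (Unitization ℂ C)).continuous.comp continuous_fst).add
      (continuous_inr.comp continuous_snd))

lemma exists_hom_of_fst_eq_zero {A C : Type*} [NonUnitalCStarAlgebra A] [NonUnitalCStarAlgebra C]
    (ψ : A →⋆ₙₐ[ℂ] Unitization ℂ C) (hψ : ∀ a, (ψ a).fst = 0) :
    ∃ χ : A →⋆ₙₐ[ℂ] C, ∀ a, (χ a : Unitization ℂ C) = ψ a := by
  have inr_snd (a : A) : ((ψ a).snd : Unitization ℂ C) = ψ a := by
    ext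
    · simp [hψ]
    · simp
  have inr_injective := Unitization.inr_injective (R := ℂ) (A := C)
  exact ⟨{ toFun := fun a => (ψ a).snd
           map_smul' := fun r a => inr_injective (by simp [inr_snd])
           map_zero' := by simp
           map_add' := fun a b => by simp
           map_mul' := fun a b => inr_injective (by simp [inr_snd, hψ])
           map_star' := fun a => by simp [map_star] }, inr_snd⟩

theorem SemiprojectiveHom.projectiveHom_comp {φ : A →⋆ₙₐ[ℂ] B} (hφ : SemiprojectiveHom φ)
    {δ : B →⋆ₙₐ[ℂ] D} (hδ : Homotopic δ 0) : ProjectiveHom (δ.comp φ) := by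
  intro C Q _ _ _ J π _ hπ σ
  obtain ⟨H, continuous_H, H_zero, H_one⟩ := hδ.symm
  have := separableSpace_unitization C
  let inrQ : Q →⋆ₙₐ[ℂ] Unitization ℂ Q := Unitization.inrNonUnitalStarAlgHom ℂ Q
  have continuous_path (b : B) : Continuous fun t => ((inrQ.comp σ).comp (H t)) b :=
    (map_continuous (inrQ.comp σ)).comp (continuous_H b)
  obtain ⟨ψ, hψ⟩ := hφ.exists_lift_path_unital (π := Unitization.starMap π)
    (Unitization.starMap_surjective hπ.surjective)
    (pathHom (fun t => (inrQ.comp σ).comp (H t)) continuous_path)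
    (fun b => by
      rw [pathHom_apply, H_zero]
      exact map_zero (inrQ.comp σ))
  have starMap_ψ (a : A) : Unitization.starMap π (ψ a) = (σ (δ (φ a)) : Unitization ℂ Q) := by
    rw [hψ, pathHom_apply, H_one]
    rfl
  obtain ⟨χ, hχ⟩ := exists_hom_of_fst_eq_zero ψ fun a => by
    simpa [Unitization.algebraMap_eq_inl] using
      congrArg (fun x : Unitization ℂ Q => x.fst) (starMap_ψ a)
  refine ⟨χ, NonUnitalStarAlgHom.ext fun a => Unitization.inr_injective (R := ℂ) ?_⟩
  exact (Unitization.starMap_inr π (χ a)).symm.trans ((congrArg _ (hχ a)).trans (starMap_ψ a))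

end Projective

section NullHomotopic

variable {A B D : Type u} [NonUnitalCStarAlgebra A] [NonUnitalCStarAlgebra B]
  [NonUnitalCStarAlgebra D]

lemma Homotopic.comp {φ φ' : A →⋆ₙₐ[ℂ] B} {ψ ψ' : B →⋆ₙₐ[ℂ] D} (h : Homotopic ψ ψ')
    (h' : Homotopic φ φ') : Homotopic (ψ.comp φ) (ψ'.comp φ') :=
  (h'.comp_left ψ).trans (h.comp_right φ')

lemma Homotopic.comp_left_zero {φ : A →⋆ₙₐ[ℂ] B} (h : Homotopic φ 0) (χ : B →⋆ₙₐ[ℂ] D) :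
    Homotopic (χ.comp φ) 0 := by
  have hzero : χ.comp (0 : A →⋆ₙₐ[ℂ] B) = 0 := NonUnitalStarAlgHom.ext fun _ => map_zero χ
  simpa only [hzero] using h.comp_left χ

namespace InductiveSystem

variable {S T : InductiveSystem.{u}}

lemma homotopic_trans_zero_of_le {k l m : ℕ} {h : k ≤ l} (hnull : Homotopic (S.trans h) 0)
    (h' : l ≤ m) : Homotopic (S.trans (h.trans h')) 0 := by
  rw [S.trans_trans h h']
  exact hnull.comp_left_zero _

lemma homotopic_trans_of_intertwining {k n : ℕ → ℕ} (hk : Monotone k) (hn : Monotone n)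
    {α : ∀ i, S.obj (k i) →⋆ₙₐ[ℂ] T.obj (n i)} {β : ∀ i, T.obj (n i) →⋆ₙₐ[ℂ] S.obj (k (i + 1))}
    (hβα : ∀ i, Homotopic ((β i).comp (α i)) (S.trans (hk i.le_succ)))
    (hαβ : ∀ i, Homotopic ((α (i + 1)).comp (β i)) (T.trans (hn i.le_succ)))
    {i j : ℕ} (hij : i ≤ j) :
    Homotopic (S.trans (hk (Nat.le_succ_of_le hij)))
      ((β j).comp ((T.trans (hn hij)).comp (α i))) := by
  induction j, hij using Nat.le_induction with
  | base =>
    rw [trans_self]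
    exact (hβα i).symm
  | succ j hij ih =>
    rw [S.trans_trans (hk (Nat.le_succ_of_le hij)) (hk (j + 1).le_succ),
      T.trans_trans (hn hij) (hn j.le_succ)]
    exact ((hβα (j + 1)).symm.comp ih).trans
      (((hαβ j).comp_right ((T.trans (hn hij)).comp (α i))).comp_left (β (j + 1)))

theorem Equivalent.exists_homotopic_zero (hST : S.Equivalent T)
    (hT : ∀ k, ∃ l, ∃ h : k ≤ l, Homotopic (T.trans h) 0) (m : ℕ) :
    ∃ l, ∃ h : m ≤ l, Homotopic (S.trans h) 0 := by
  obtain ⟨k, n, hkn, hnk, α, β, hβα, hαβ⟩ := hST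
  have hk : StrictMono k := strictMono_nat_of_lt_succ fun i => (hkn i).trans (hnk i)
  have hn : StrictMono n := strictMono_nat_of_lt_succ fun i => (hnk i).trans (hkn (i + 1))
  obtain ⟨p, hp, hTp⟩ := hT (n m)
  obtain ⟨j, hmj, hpj⟩ : ∃ j, m ≤ j ∧ p ≤ n j :=
    ⟨max m p, le_max_left _ _, (le_max_right m p).trans hn.le_apply⟩
  have hTj : Homotopic (T.trans (hn.monotone hmj)) 0 := homotopic_trans_zero_of_le hTp hpj
  have hSj : Homotopic (S.trans (hk.monotone (Nat.le_succ_of_le hmj))) 0 :=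
    (homotopic_trans_of_intertwining hk.monotone hn.monotone hβα hαβ hmj).trans
      ((hTj.comp_right (α m)).comp_left_zero (β j))
  refine ⟨k (j + 1), hk.le_apply.trans (hk.monotone (Nat.le_succ_of_le hmj)), ?_⟩
  rw [S.trans_trans hk.le_apply (hk.monotone (Nat.le_succ_of_le hmj))]
  exact hSj.comp_right (S.trans hk.le_apply)

end InductiveSystem

theorem IsWeaklySemiprojective.isWeaklyProjective [TopologicalSpace.SeparableSpace A]
    (hA : IsWeaklySemiprojective A) (hA' : HasTrivialShape A) : IsWeaklyProjective A := by
  obtain ⟨S, T, ⟨⟨ι, hι⟩, hS⟩, hT, hST⟩ := hA'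
  intro C Q _ _ _ J π hJ hπ σ ε F hε
  obtain ⟨n, ψ, hψ⟩ := hι.exists_approx_section hA F hε
  obtain ⟨l, hl, hnull⟩ := hST.exists_homotopic_zero hT.exists_homotopic_zero (n + 1)
  obtain ⟨χ, hχ⟩ := (hS n).projectiveHom_comp hnull C Q J π hJ hπ (σ.comp (ι l))
  have π_χ (x : S.obj n) : π (χ x) = σ (ι n x) :=
    calc π (χ x) = σ (ι l (S.trans hl (S.map n x))) := DFunLike.congr_fun hχ x
      _ = σ (ι (n + 1) (S.map n x)) := by rw [hι.apply_trans]
      _ = σ (ι n x) := congrArg σ (DFunLike.congr_fun (hι.compat n) x)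
  refine ⟨χ.comp ψ, fun a ha => ?_⟩
  change ‖π (χ (ψ a)) - σ a‖ < ε
  rw [π_χ, ← map_sub]
  exact (NonUnitalStarAlgHom.norm_apply_le σ _).trans_lt (hψ a ha)

end NullHomotopic

section GeneratedInduction

variable {C D E : Type*} [NonUnitalCStarAlgebra C] [NonUnitalCStarAlgebra D]
  [NonUnitalCStarAlgebra E]

lemma generated_induction {s : Set C} {p : generated s → Prop}
    (mem : ∀ x (hx : x ∈ s), p ⟨x, subset_generated s hx⟩) (zero : p 0)
    (add : ∀ x y, p x → p y → p (x + y)) (mul : ∀ x y, p x → p y → p (x * y))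
    (smul : ∀ (r : ℂ) x, p x → p (r • x)) (star : ∀ x, p x → p (star x))
    (closed : IsClosed {x | p x}) (x : generated s) : p x := by
  let S : NonUnitalStarSubalgebra ℂ (generated s) :=
    { carrier := {x | p x}
      add_mem' := add _ _
      zero_mem' := zero
      mul_mem' := mul _ _
      smul_mem' := fun r _ => smul r _
      star_mem' := star _ }
  let val : generated s →⋆ₙₐ[ℂ] C := NonUnitalStarSubalgebraClass.subtype (generated s)
  have isClosed_map : IsClosed (S.map val : Set C) :=
    (isClosed_generated s).isClosedEmbedding_subtypeVal.isClosedMap _ closed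
  obtain ⟨y, hy, hyx⟩ := generated_le isClosed_map
    (fun x hx => ⟨⟨x, subset_generated s hx⟩, mem x hx, rfl⟩) x.2
  exact Subtype.ext hyx ▸ hy

lemma exists_factor_of_ker_le {q : C →⋆ₙₐ[ℂ] D} (hq : Function.Surjective q) (f : C →⋆ₙₐ[ℂ] E)
    (hker : ∀ y, q y = 0 → f y = 0) : ∃ g : D →⋆ₙₐ[ℂ] E, ∀ y, g (q y) = f y := by
  have f_eq_of_q_eq {y y' : C} (h : q y = q y') : f y = f y' :=
    sub_eq_zero.1 (map_sub f y y' ▸ hker _ (by rw [map_sub, h, sub_self]))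
  let s := Function.surjInv hq
  have q_s (d : D) : q (s d) = d := Function.surjInv_eq hq d
  exact ⟨{ toFun := fun d => f (s d)
           map_smul' := fun r d => (f_eq_of_q_eq (by simp [q_s])).trans (map_smul f r (s d))
           map_zero' := hker _ (q_s 0)
           map_add' := fun d e => (f_eq_of_q_eq (by simp [q_s])).trans (map_add f (s d) (s e))
           map_mul' := fun d e => (f_eq_of_q_eq (by simp [q_s])).trans (map_mul f (s d) (s e))
           map_star' := fun d =>
            (f_eq_of_q_eq (by simp [q_s, map_star])).trans (map_star f (s d)) },
    fun y => f_eq_of_q_eq (q_s _)⟩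

end GeneratedInduction

section StarPolynomials

/-- Formal noncommutative star polynomials without constant term in variables indexed by `ℕ`. -/
inductive Term : Type
  | gen : ℕ → Term
  | add : Term → Term → Term
  | mul : Term → Term → Term
  | smul : ℂ → Term → Term
  | star : Term → Term

variable {B D : Type*} [NonUnitalCStarAlgebra B] [NonUnitalCStarAlgebra D]

/-- Evaluation of a formal star polynomial at a sequence. -/
def Term.eval (x : ℕ → B) : Term → B
  | .gen n => x n
  | .add s t => s.eval x + t.eval x
  | .mul s t => s.eval x * t.eval x
  | .smul r t => r • t.eval x
  | .star t => Star.star (t.eval x)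

lemma Term.map_eval (f : B →⋆ₙₐ[ℂ] D) (x : ℕ → B) (t : Term) :
    f (t.eval x) = t.eval fun n => f (x n) := by
  induction t with
  | gen n => rfl
  | add s t hs ht => simp [Term.eval, hs, ht]
  | mul s t hs ht => simp [Term.eval, hs, ht]
  | smul r t ht => simp [Term.eval, ht]
  | star t ht => simp [Term.eval, ht, map_star]

lemma exists_eval_eq_of_mem_adjoin (x : ℕ → B) {b : B}
    (hb : b ∈ NonUnitalStarAlgebra.adjoin ℂ (Set.range x)) : ∃ t : Term, t.eval x = b := by
  induction hb using NonUnitalStarAlgebra.adjoin_induction with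
  | mem y hy =>
    obtain ⟨n, rfl⟩ := hy
    exact ⟨.gen n, rfl⟩
  | zero => exact ⟨.smul 0 (.gen 0), by simp [Term.eval]⟩
  | add a b _ _ ha hb =>
    obtain ⟨s, rfl⟩ := ha
    obtain ⟨t, rfl⟩ := hb
    exact ⟨.add s t, rfl⟩
  | mul a b _ _ ha hb =>
    obtain ⟨s, rfl⟩ := ha
    obtain ⟨t, rfl⟩ := hb
    exact ⟨.mul s t, rfl⟩
  | smul r a _ ha =>
    obtain ⟨s, rfl⟩ := ha
    exact ⟨.smul r s, rfl⟩
  | star a _ ha =>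
    obtain ⟨s, rfl⟩ := ha
    exact ⟨.star s, rfl⟩

lemma denseRange_eval {x : ℕ → B} (hx : ∀ b, b ∈ generated (Set.range x)) :
    DenseRange fun t : Term => t.eval x := fun b =>
  closure_mono (fun _ hb => exists_eval_eq_of_mem_adjoin x hb) (hx b)

lemma norm_snd_le_norm_fst_of_mem_generated {g : ℕ → B} {x : ℕ → D}
    (h : ∀ t : Term, ‖t.eval x‖ ≤ ‖t.eval g‖) {z : B × D}
    (hz : z ∈ generated (Set.range fun n => (g n, x n))) : ‖z.2‖ ≤ ‖z.1‖ := by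
  refine closure_minimal (t := {z : B × D | ‖z.2‖ ≤ ‖z.1‖}) (fun z hz => ?_)
    (isClosed_le continuous_snd.norm continuous_fst.norm) hz
  obtain ⟨t, rfl⟩ := exists_eval_eq_of_mem_adjoin _ hz
  have fst_eval : (t.eval fun n => (g n, x n)).1 = t.eval g :=
    t.map_eval (NonUnitalStarAlgHom.fst ℂ B D) _
  have snd_eval : (t.eval fun n => (g n, x n)).2 = t.eval x :=
    t.map_eval (NonUnitalStarAlgHom.snd ℂ B D) _
  simpa only [Set.mem_ofPred_eq, fst_eval, snd_eval] using h t

-- The C*-algebra generated by the pairs `(g n, x n)` is the graph of the homomorphism.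
lemma exists_hom_of_norm_eval_le {g : ℕ → B} {x : ℕ → D}
    (hg : ∀ y, y ∈ generated (Set.range g)) (h : ∀ t : Term, ‖t.eval x‖ ≤ ‖t.eval g‖) :
    ∃ f : B →⋆ₙₐ[ℂ] D, ∀ n, f (g n) = x n := by
  let graph := generated (Set.range fun n => (g n, x n))
  let fst : graph →⋆ₙₐ[ℂ] B :=
    (NonUnitalStarAlgHom.fst ℂ _ _).comp (NonUnitalStarSubalgebraClass.subtype _)
  let snd : graph →⋆ₙₐ[ℂ] D :=
    (NonUnitalStarAlgHom.snd ℂ _ _).comp (NonUnitalStarSubalgebraClass.subtype _)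
  let pair (n : ℕ) : graph := ⟨(g n, x n), subset_generated _ ⟨n, rfl⟩⟩
  have fst_surjective : Function.Surjective fst := fun y =>
    generated_le (S := NonUnitalStarAlgHom.range fst)
      (by rw [NonUnitalStarAlgHom.coe_range]; exact isClosed_range fst)
      (by rintro _ ⟨n, rfl⟩; exact ⟨pair n, rfl⟩) (hg y)
  have snd_eq_zero (z : graph) (hz : fst z = 0) : snd z = 0 := by
    have hle : ‖snd z‖ ≤ ‖fst z‖ := norm_snd_le_norm_fst_of_mem_generated h z.2
    simpa [hz] using hle
  obtain ⟨f, hf⟩ := exists_factor_of_ker_le fst_surjective snd snd_eq_zero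
  exact ⟨f, fun n => hf (pair n)⟩

end StarPolynomials

section Universal

/-- Sequences of selfadjoint contractions. -/
def IsContractionSeq {B : Type*} [NonUnitalCStarAlgebra B] (x : ℕ → B) : Prop :=
  ∀ n, IsSelfAdjoint (x n) ∧ ‖x n‖ ≤ 1

lemma IsContractionSeq.map {B D : Type*} [NonUnitalCStarAlgebra B] [NonUnitalCStarAlgebra D]
    {x : ℕ → B} (hx : IsContractionSeq x) (f : B →⋆ₙₐ[ℂ] D) :
    IsContractionSeq fun n => f (x n) :=
  fun n => ⟨(hx n).1.map f, (NonUnitalStarAlgHom.norm_apply_le f _).trans (hx n).2⟩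

/-- The seminorms on formal star polynomials given by sequences of selfadjoint contractions. They
form a set, unlike those sequences themselves, so the universal algebra can be built as a
subalgebra of a product over it. -/
def termNorms : Set (Term → ℝ) :=
  {ν | ∃ (B : Type u) (_ : NonUnitalCStarAlgebra B) (x : ℕ → B), IsContractionSeq x ∧
    ∀ t : Term, ν t = ‖t.eval x‖}

/-- An algebra containing a sequence that realizes a given seminorm. -/
def ModelAlg (ν : termNorms.{u}) : Type u := ν.2.choose

noncomputable instance (ν : termNorms.{u}) : NonUnitalCStarAlgebra (ModelAlg ν) :=
  ν.2.choose_spec.choose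

/-- A sequence of selfadjoint contractions realizing a given seminorm. -/
noncomputable def modelSeq (ν : termNorms.{u}) : ℕ → ModelAlg ν :=
  ν.2.choose_spec.choose_spec.choose

lemma isContractionSeq_modelSeq (ν : termNorms.{u}) : IsContractionSeq (modelSeq ν) :=
  ν.2.choose_spec.choose_spec.choose_spec.1

lemma norm_eval_modelSeq (ν : termNorms.{u}) (t : Term) : ‖t.eval (modelSeq ν)‖ = ν.1 t :=
  (ν.2.choose_spec.choose_spec.choose_spec.2 t).symm

/-- The sequence of selfadjoint contractions whose coordinates are all the model sequences. -/
noncomputable def univSeq (n : ℕ) : lp ModelAlg.{u} ∞ :=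
  ⟨fun ν => modelSeq ν n, memℓp_infty ⟨1, by
    rintro _ ⟨ν, rfl⟩
    exact (isContractionSeq_modelSeq ν n).2⟩⟩

/-- The universal C*-algebra generated by a sequence of selfadjoint contractions. -/
def UnivAlg : Type u := generated (Set.range univSeq.{u})

noncomputable instance : NonUnitalCStarAlgebra UnivAlg.{u} :=
  inferInstanceAs (NonUnitalCStarAlgebra (generated (Set.range univSeq.{u})))

instance : TopologicalSpace.SeparableSpace UnivAlg.{u} :=
  separableSpace_generated (Set.countable_range _)

/-- The generators of the universal algebra. -/
noncomputable def univGen (n : ℕ) : UnivAlg.{u} := ⟨univSeq n, subset_generated _ ⟨n, rfl⟩⟩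

lemma isContractionSeq_univGen : IsContractionSeq univGen.{u} := fun n =>
  ⟨Subtype.ext (lp.ext (funext fun ν => (isContractionSeq_modelSeq ν n).1)),
    lp.norm_le_of_forall_le zero_le_one fun ν => (isContractionSeq_modelSeq ν n).2⟩

/-- The representation of the universal algebra on the model of a given seminorm. -/
noncomputable def univCoord (ν : termNorms.{u}) : UnivAlg.{u} →⋆ₙₐ[ℂ] ModelAlg ν :=
  (coordHom ModelAlg ν).comp (NonUnitalStarSubalgebraClass.subtype (generated (Set.range univSeq)))

lemma univCoord_eval_univGen (ν : termNorms.{u}) (t : Term) :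
    univCoord ν (t.eval univGen) = t.eval (modelSeq ν) :=
  t.map_eval (univCoord ν) univGen

lemma mem_generated_univGen (y : UnivAlg.{u}) : y ∈ generated (Set.range univGen.{u}) := by
  let G := generated (Set.range univGen.{u})
  refine generated_induction (p := (· ∈ G)) ?_ (zero_mem G) (fun _ _ => G.add_mem)
    (fun _ _ => G.mul_mem) (fun r _ => G.smul_mem r) (fun _ => G.star_mem')
    (isClosed_generated _) y
  rintro _ ⟨n, rfl⟩
  exact subset_generated _ ⟨n, rfl⟩

variable {B : Type u} [NonUnitalCStarAlgebra B]

lemma univAlg_hom_ext {f g : UnivAlg.{u} →⋆ₙₐ[ℂ] B} (h : ∀ n, f (univGen n) = g (univGen n)) :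
    f = g := by
  refine DFunLike.coe_injective
    ((denseRange_eval mem_generated_univGen).equalizer (map_continuous f) (map_continuous g) ?_)
  funext t
  simp only [Function.comp_apply, t.map_eval, h]

theorem exists_univAlg_hom {x : ℕ → B} (hx : IsContractionSeq x) :
    ∃ f : UnivAlg.{u} →⋆ₙₐ[ℂ] B, ∀ n, f (univGen n) = x n := by
  let ν : termNorms.{u} := ⟨fun t => ‖t.eval x‖, B, inferInstance, x, hx, fun _ => rfl⟩
  refine exists_hom_of_norm_eval_le mem_generated_univGen fun t => ?_
  calc ‖t.eval x‖ = ‖univCoord ν (t.eval univGen)‖ := by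
        rw [univCoord_eval_univGen, norm_eval_modelSeq]
    _ ≤ _ := NonUnitalStarAlgHom.norm_apply_le _ _

lemma exists_norm_univCoord_eq (f : UnivAlg.{u} →⋆ₙₐ[ℂ] B) :
    ∃ ν : termNorms.{u}, ∀ y, ‖univCoord ν y‖ = ‖f y‖ := by
  let ν : termNorms.{u} := ⟨fun t => ‖t.eval fun n => f (univGen n)‖, B, inferInstance, _,
    isContractionSeq_univGen.map f, fun _ => rfl⟩
  refine ⟨ν, congrFun ((denseRange_eval mem_generated_univGen).equalizer
    (map_continuous _).norm (map_continuous f).norm (funext fun t => ?_))⟩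
  simp only [Function.comp_apply]
  rw [univCoord_eval_univGen, norm_eval_modelSeq, t.map_eval]

end Universal

section AsymptoticNorms

variable {C D : Type*} [NonUnitalCStarAlgebra C] [NonUnitalCStarAlgebra D]

lemma exists_mem_ker_norm_star_mul_self_sub_le (f : C →⋆ₙₐ[ℂ] D) (c : C) :
    ∃ z, f z = 0 ∧ ‖star c * c - z‖ ≤ ‖f c‖ ^ 2 := by
  obtain ⟨e, -, hfe, he⟩ := exists_isSelfAdjoint_preimage_norm_le f ⟨star c * c, rfl⟩
    ((IsSelfAdjoint.star_mul_self c).map f) le_rfl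
  rw [map_mul, map_star, CStarRing.norm_star_mul_self, ← sq] at he
  exact ⟨star c * c - e, by rw [map_sub, hfe, sub_self], by rwa [sub_sub_cancel]⟩

lemma norm_map_sq_le_add (f : C →⋆ₙₐ[ℂ] D) (c z : C) :
    ‖f c‖ ^ 2 ≤ ‖star c * c - z‖ + ‖f z‖ := by
  calc ‖f c‖ ^ 2 = ‖f (star c * c - z) + f z‖ := by
        rw [← map_add, sub_add_cancel, map_mul, map_star, CStarRing.norm_star_mul_self, sq]
    _ ≤ ‖f (star c * c - z)‖ + ‖f z‖ := norm_add_le _ _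
    _ ≤ _ := by
        gcongr
        exact NonUnitalStarAlgHom.norm_apply_le f _

variable {ι : Type*} {E : ι → Type*} [∀ i, NonUnitalCStarAlgebra (E i)]
  {ρ : ∀ i, C →⋆ₙₐ[ℂ] E i} {l : Filter ι}

lemma tendsto_norm_zero_of_mem_closure {s : Set C}
    (hs : ∀ z ∈ s, Tendsto (fun i => ‖ρ i z‖) l (𝓝 0)) {z : C} (hz : z ∈ closure s) :
    Tendsto (fun i => ‖ρ i z‖) l (𝓝 0) := by
  refine tendsto_order.2 ⟨fun r hr => .of_forall fun i => hr.trans_le (norm_nonneg _),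
    fun ε hε => ?_⟩
  obtain ⟨z', hz', hzz'⟩ := Metric.mem_closure_iff.1 hz (ε / 2) (half_pos hε)
  rw [dist_eq_norm] at hzz'
  filter_upwards [(hs z' hz').eventually (gt_mem_nhds (half_pos hε))] with i hi
  calc ‖ρ i z‖ ≤ ‖ρ i (z - z')‖ + ‖ρ i z'‖ := by
        rw [map_sub]
        exact norm_le_norm_sub_add _ _
    _ < ε := by linarith [NonUnitalStarAlgHom.norm_apply_le (ρ i) (z - z')]

lemma eventually_norm_lt_of_tendsto_ker {f : C →⋆ₙₐ[ℂ] D}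
    (hker : ∀ z, f z = 0 → Tendsto (fun i => ‖ρ i z‖) l (𝓝 0)) {c : C} {r : ℝ} (hc : ‖f c‖ < r) :
    ∀ᶠ i in l, ‖ρ i c‖ < r := by
  obtain ⟨z, hz, hcz⟩ := exists_mem_ker_norm_star_mul_self_sub_le f c
  have hr : 0 ≤ r := (norm_nonneg _).trans hc.le
  have hgap : 0 < r ^ 2 - ‖f c‖ ^ 2 := sub_pos.2 (by gcongr)
  filter_upwards [(hker z hz).eventually (gt_mem_nhds hgap)] with i hi
  exact lt_of_pow_lt_pow_left₀ 2 hr (by linarith [norm_map_sq_le_add (ρ i) c z])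

lemma eventually_forall_norm_lt_of_tendsto_ker {f : C →⋆ₙₐ[ℂ] D}
    (hker : ∀ z, f z = 0 → Tendsto (fun i => ‖ρ i z‖) l (𝓝 0)) {K : Set C} (hK : IsCompact K)
    {r : ℝ} (hr : ∀ c ∈ K, ‖f c‖ < r) : ∀ᶠ i in l, ∀ c ∈ K, ‖ρ i c‖ < r := by
  refine hK.induction_on (p := fun s => ∀ᶠ i in l, ∀ c ∈ s, ‖ρ i c‖ < r) (by simp)
    (fun s t hst ht => ht.mono fun i hi c hc => hi c (hst hc))
    (fun s t hs ht => ?_) (fun c hc => ?_)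
  · filter_upwards [hs, ht] with i hsi hti c hc using hc.elim (hsi c) (hti c)
  · obtain ⟨r', hcr', hr'⟩ := exists_between (hr c hc)
    refine ⟨Metric.ball c (r - r'),
      mem_nhdsWithin_of_mem_nhds (Metric.ball_mem_nhds c (sub_pos.2 hr')), ?_⟩
    filter_upwards [eventually_norm_lt_of_tendsto_ker hker hcr'] with i hi c' hc'
    rw [mem_ball_iff_norm] at hc'
    calc ‖ρ i c'‖ ≤ ‖ρ i (c' - c)‖ + ‖ρ i c‖ := by
          rw [map_sub]
          exact norm_le_norm_sub_add _ _
      _ < r := by linarith [NonUnitalStarAlgHom.norm_apply_le (ρ i) (c' - c)]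

end AsymptoticNorms

section FreeAlgebra

variable {B D : Type u} [NonUnitalCStarAlgebra B] [NonUnitalCStarAlgebra D]

lemma exists_univAlg_lift {π : B →⋆ₙₐ[ℂ] D} (hπ : Function.Surjective π)
    (σ : UnivAlg.{u} →⋆ₙₐ[ℂ] D) : ∃ f : UnivAlg.{u} →⋆ₙₐ[ℂ] B, π.comp f = σ := by
  have hσ := isContractionSeq_univGen.map σ
  choose c hsa hπc hc using fun n =>
    exists_isSelfAdjoint_preimage_norm_le π (hπ _) (hσ n).1 (hσ n).2
  obtain ⟨f, hf⟩ := exists_univAlg_hom fun n => ⟨hsa n, hc n⟩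
  exact ⟨f, univAlg_hom_ext fun n => (congrArg π (hf n)).trans (hπc n)⟩

lemma tendsto_norm_sub_of_univGen {C : ℕ → Type*} [∀ n, NonUnitalCStarAlgebra (C n)]
    {f g : ∀ n, UnivAlg.{u} →⋆ₙₐ[ℂ] C n}
    (h : ∀ j, Tendsto (fun n => ‖f n (univGen j) - g n (univGen j)‖) atTop (𝓝 0))
    (y : UnivAlg.{u}) : Tendsto (fun n => ‖f n y - g n y‖) atTop (𝓝 0) := by
  refine mem_nullSequences.1 (generated_le (isClosed_asymptoticEqualizer (prodHom f) (prodHom g))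
    ?_ (mem_generated_univGen y))
  rintro _ ⟨j, rfl⟩
  exact mem_nullSequences.2 (h j)

lemma convex_selfAdjoint_contractions (B : Type*) [NonUnitalCStarAlgebra B] :
    Convex ℝ {a : B | IsSelfAdjoint a ∧ ‖a‖ ≤ 1} := by
  have hball : Convex ℝ {a : B | ‖a‖ ≤ 1} := by
    simpa only [Metric.closedBall, dist_zero_right] using convex_closedBall (0 : B) 1
  exact (selfAdjoint.submodule ℝ B).convex.inter hball

lemma exists_linear_path (f g : UnivAlg.{u} →⋆ₙₐ[ℂ] B) :
    ∃ ψ : UnivAlg.{u} →⋆ₙₐ[ℂ] C(unitInterval, B),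
      (evalHom B 0).comp ψ = f ∧ (evalHom B 1).comp ψ = g ∧
      ∀ n t, ψ (univGen n) t = AffineMap.lineMap (f (univGen n)) (g (univGen n)) (t : ℝ) := by
  let segment (n : ℕ) : C(unitInterval, B) :=
    ⟨fun t => AffineMap.lineMap (f (univGen n)) (g (univGen n)) (t : ℝ), by fun_prop⟩
  have segment_mem (n : ℕ) (t : unitInterval) :
      IsSelfAdjoint (segment n t) ∧ ‖segment n t‖ ≤ 1 :=
    (convex_selfAdjoint_contractions B).lineMap_mem (isContractionSeq_univGen.map f n)
      (isContractionSeq_univGen.map g n) t.2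
  obtain ⟨ψ, hψ⟩ := exists_univAlg_hom (x := segment) fun n =>
    ⟨ContinuousMap.ext fun t => (segment_mem n t).1,
      (ContinuousMap.norm_le _ zero_le_one).2 fun t => (segment_mem n t).2⟩
  refine ⟨ψ, univAlg_hom_ext fun n => ?_, univAlg_hom_ext fun n => ?_, fun n t => by rw [hψ]; rfl⟩
  · simp [hψ, segment]
  · simp [hψ, segment]

lemma homotopic_of_univAlg (f g : UnivAlg.{u} →⋆ₙₐ[ℂ] B) : Homotopic f g := by
  obtain ⟨ψ, rfl, rfl, -⟩ := exists_linear_path f g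
  exact homotopic_of_path ψ

lemma norm_map_lineMap_sub_le (f : B →⋆ₙₐ[ℂ] D) (a b : B) (t : unitInterval) :
    ‖f (AffineMap.lineMap a b (t : ℝ)) - f a‖ ≤ ‖f a - f b‖ := by
  have hmap : f (AffineMap.lineMap a b (t : ℝ)) - f a = (t : ℝ) • (f b - f a) := by
    rw [AffineMap.lineMap_apply_module', map_add, add_sub_cancel_right,
      map_real_smul f (map_continuous f), map_sub]
  rw [hmap, norm_smul, Real.norm_of_nonneg t.2.1, norm_sub_rev]
  exact mul_le_of_le_one_left (norm_nonneg _) t.2.2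

/-- Composition of paths with a homomorphism. -/
noncomputable def mapPath (f : B →⋆ₙₐ[ℂ] D) : C(unitInterval, B) →⋆ₙₐ[ℂ] C(unitInterval, D) :=
  pathHom (fun t => f.comp (evalHom B t)) fun ω => (map_continuous f).comp ω.continuous

variable {A : Type u} [NonUnitalCStarAlgebra A] [TopologicalSpace.SeparableSpace A]

theorem IsWeaklyProjective.exists_path (hA : IsWeaklyProjective A) {f : UnivAlg.{u} →⋆ₙₐ[ℂ] A}
    (hf : Function.Surjective f) {s : Set UnivAlg.{u}} (hs : s.Finite) (hker : ∀ y ∈ s, f y = 0)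
    {ε : ℝ} (hε : 0 < ε) :
    ∃ (σ : A →⋆ₙₐ[ℂ] UnivAlg.{u}) (ψ : UnivAlg.{u} →⋆ₙₐ[ℂ] C(unitInterval, UnivAlg.{u})),
      (∀ y, ψ y 0 = y) ∧ (∀ y, ψ y 1 = σ (f y)) ∧ ∀ y ∈ s, ∀ t, ‖f (ψ y t)‖ < ε := by
  obtain ⟨σ, hσ⟩ := WeaklyProjectiveHom.exists_seq_tendsto hA hf (NonUnitalStarAlgHom.id ℂ A)
  choose ψ ψ_zero ψ_one ψ_gen using fun n =>
    exists_linear_path (NonUnitalStarAlgHom.id ℂ UnivAlg.{u}) ((σ n).comp f)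
  let const : UnivAlg.{u} →⋆ₙₐ[ℂ] C(unitInterval, A) := pathHom (fun _ => f) fun _ => by fun_prop
  have tendsto_gen (j : ℕ) : Tendsto
      (fun n => ‖((mapPath f).comp (ψ n)) (univGen j) - const (univGen j)‖) atTop (𝓝 0) := by
    refine squeeze_zero (fun _ => norm_nonneg _) (fun n => ?_) (hσ (f (univGen j)))
    refine (ContinuousMap.norm_le _ (norm_nonneg _)).2 fun t => ?_
    change ‖f (ψ n (univGen j) t) - f (univGen j)‖ ≤ _
    rw [ψ_gen]
    exact norm_map_lineMap_sub_le f _ _ t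
  have eventually_lt : ∀ᶠ n in atTop, ∀ y ∈ s, ‖mapPath f (ψ n y) - const y‖ < ε :=
    hs.eventually_all.2 fun y _ =>
      (tendsto_norm_sub_of_univGen tendsto_gen y).eventually (gt_mem_nhds hε)
  obtain ⟨n, hn⟩ := eventually_lt.exists
  refine ⟨σ n, ψ n, DFunLike.congr_fun (ψ_zero n), DFunLike.congr_fun (ψ_one n),
    fun y hy t => ?_⟩
  have hsub : (mapPath f (ψ n y) - const y) t = f (ψ n y t) := by
    change f (ψ n y t) - f y = _
    rw [hker y hy, sub_zero]
  exact hsub ▸ (ContinuousMap.norm_coe_le_norm _ t).trans_lt (hn y hy)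

end FreeAlgebra

section Stage

variable (r : ℕ → UnivAlg.{u}) (k : ℕ)

/-- The models in which the relations `r 0 = 0, …, r k = 0` hold up to an error `1 / (k + 1)`. -/
def RelModels : Type :=
  {ν : termNorms.{u} // ∀ j ≤ k, ‖univCoord ν (r j)‖ ≤ 1 / ((k : ℝ) + 1)}

/-- The representation of the universal algebra on the product of the models in `RelModels`. -/
noncomputable def relHom : UnivAlg.{u} →⋆ₙₐ[ℂ] lp (fun ν : RelModels r k => ModelAlg ν.1) ∞ :=
  prodHom fun ν => univCoord ν.1

instance isClosed_range_relHom : IsClosed (NonUnitalStarAlgHom.range (relHom r k) :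
    Set (lp (fun ν : RelModels r k => ModelAlg ν.1) ∞)) := by
  rw [NonUnitalStarAlgHom.coe_range]
  exact isClosed_range _

/-- The universal C*-algebra generated by a sequence of selfadjoint contractions subject to the
relaxed relations `‖r j‖ ≤ 1 / (k + 1)` for `j ≤ k`. -/
def Stage : Type u := NonUnitalStarAlgHom.range (relHom r k)

noncomputable instance : NonUnitalCStarAlgebra (Stage r k) :=
  inferInstanceAs (NonUnitalCStarAlgebra (NonUnitalStarAlgHom.range (relHom r k)))

/-- The quotient map from the universal algebra. -/
noncomputable def stageHom : UnivAlg.{u} →⋆ₙₐ[ℂ] Stage r k :=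
  NonUnitalStarAlgHom.codRestrict (relHom r k) (NonUnitalStarAlgHom.range (relHom r k))
    (NonUnitalStarAlgHom.mem_range_self _)

lemma stageHom_surjective : Function.Surjective (stageHom r k) := by
  rintro ⟨_, y, rfl⟩
  exact ⟨y, rfl⟩

instance : TopologicalSpace.SeparableSpace (Stage r k) :=
  (stageHom_surjective r k).denseRange.separableSpace (map_continuous _)

variable {r k} {B : Type u} [NonUnitalCStarAlgebra B]

lemma norm_stageHom_le {j : ℕ} (h : j ≤ k) : ‖stageHom r k (r j)‖ ≤ 1 / ((k : ℝ) + 1) :=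
  lp.norm_le_of_forall_le (f := relHom r k (r j)) (by positivity) fun ν => ν.2 j h

lemma exists_stage_hom (f : UnivAlg.{u} →⋆ₙₐ[ℂ] B)
    (h : ∀ j ≤ k, ‖f (r j)‖ ≤ 1 / ((k : ℝ) + 1)) :
    ∃ g : Stage r k →⋆ₙₐ[ℂ] B, ∀ y, g (stageHom r k y) = f y := by
  obtain ⟨ν, hν⟩ := exists_norm_univCoord_eq f
  refine exists_factor_of_ker_le (stageHom_surjective r k) f fun y hy => ?_
  have hrel : relHom r k y = 0 := congrArg Subtype.val hy
  have hcoord : univCoord ν y = 0 :=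
    congrArg (fun x : lp (fun ν : RelModels r k => ModelAlg ν.1) ∞ =>
      x ⟨ν, fun j hj => (hν _).trans_le (h j hj)⟩) hrel
  rw [← norm_eq_zero, ← hν, hcoord, norm_zero]

/-- The homomorphism out of a stage induced by a homomorphism out of the universal algebra that
satisfies the relaxed relations. -/
noncomputable def stageDesc (f : UnivAlg.{u} →⋆ₙₐ[ℂ] B)
    (h : ∀ j ≤ k, ‖f (r j)‖ ≤ 1 / ((k : ℝ) + 1)) : Stage r k →⋆ₙₐ[ℂ] B :=
  (exists_stage_hom f h).choose

lemma stageDesc_stageHom (f : UnivAlg.{u} →⋆ₙₐ[ℂ] B)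
    (h : ∀ j ≤ k, ‖f (r j)‖ ≤ 1 / ((k : ℝ) + 1)) (y : UnivAlg.{u}) :
    stageDesc f h (stageHom r k y) = f y :=
  (exists_stage_hom f h).choose_spec y

lemma stage_hom_ext {f g : Stage r k →⋆ₙₐ[ℂ] B}
    (h : ∀ y, f (stageHom r k y) = g (stageHom r k y)) : f = g :=
  DFunLike.coe_injective ((stageHom_surjective r k).injective_comp_right (funext h))

variable (r k) in
/-- The quotient map between consecutive stages, along which the relations become stricter. -/
noncomputable def stageMap : Stage r k →⋆ₙₐ[ℂ] Stage r (k + 1) :=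
  stageDesc (stageHom r (k + 1)) fun _ hj =>
    (norm_stageHom_le (Nat.le_succ_of_le hj)).trans (Nat.one_div_le_one_div k.le_succ)

lemma stageMap_stageHom (y : UnivAlg.{u}) :
    stageMap r k (stageHom r k y) = stageHom r (k + 1) y := by
  rw [stageMap, stageDesc_stageHom]

variable (r) in
/-- The inductive system of the stages. -/
noncomputable abbrev stageSystem : InductiveSystem.{u} where
  obj := Stage r
  map := stageMap r

lemma stageSystem_trans {l : ℕ} (h : k ≤ l) (y : UnivAlg.{u}) :
    (stageSystem r).trans h (stageHom r k y) = stageHom r l y := by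
  induction l, h using Nat.le_induction with
  | base => rw [InductiveSystem.trans_self]; rfl
  | succ l hl ih =>
    rw [InductiveSystem.trans_succ _ hl, NonUnitalStarAlgHom.comp_apply, ih, stageMap_stageHom]

lemma tendsto_norm_zero_of_isQuotientBy {C Q : Type u} [NonUnitalCStarAlgebra C]
    [NonUnitalCStarAlgebra Q] {D : ℕ → Type u} [∀ k, NonUnitalCStarAlgebra (D k)]
    {J : ℕ → TwoSidedIdeal C} (hJ : Monotone J) {ρ : ∀ k, C →⋆ₙₐ[ℂ] D k}
    (hρ : ∀ k, IsQuotientBy (J k : Set C) (ρ k)) {π : C →⋆ₙₐ[ℂ] Q}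
    (hπ : IsQuotientBy (closure (⋃ k, (J k : Set C))) π) {z : C} (hz : π z = 0) :
    Tendsto (fun k => ‖ρ k z‖) atTop (𝓝 0) := by
  refine tendsto_norm_zero_of_mem_closure (fun x hx => ?_) ((hπ.mem_iff z).2 hz)
  obtain ⟨m, hm⟩ := Set.mem_iUnion.1 hx
  refine tendsto_const_nhds.congr' ?_
  filter_upwards [eventually_ge_atTop m] with k hk
  rw [((hρ k).mem_iff x).1 (hJ hk hm), norm_zero]

-- A lift of the generators satisfies the relations of stage `k + 1` in the limit quotient, hence
-- the weaker relations of stage `k` in some earlier quotient.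
theorem semiprojectiveHom_stageMap (r : ℕ → UnivAlg.{u}) (k : ℕ) :
    SemiprojectiveHom (stageMap r k) := by
  intro C _ _ J _ hJ D _ Q _ ρ π p hρ hπ hp σ
  obtain ⟨f, hf⟩ := exists_univAlg_lift hπ.surjective (σ.comp (stageHom r (k + 1)))
  have hπf (y : UnivAlg.{u}) : π (f y) = σ (stageHom r (k + 1) y) := DFunLike.congr_fun hf y
  have norm_lt (j : ℕ) (hj : j ∈ Set.Iic k) : ‖π (f (r j))‖ < 1 / ((k : ℝ) + 1) :=
    calc ‖π (f (r j))‖ ≤ ‖stageHom r (k + 1) (r j)‖ := by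
          rw [hπf]
          exact NonUnitalStarAlgHom.norm_apply_le σ _
      _ ≤ 1 / ((k + 1 : ℕ) + 1 : ℝ) := norm_stageHom_le (Nat.le_succ_of_le hj)
      _ < 1 / ((k : ℝ) + 1) := Nat.one_div_lt_one_div k.lt_succ_self
  have eventually_norm_lt : ∀ᶠ m in atTop, ∀ j ∈ Set.Iic k,
      ‖ρ m (f (r j))‖ < 1 / ((k : ℝ) + 1) :=
    (Set.finite_Iic k).eventually_all.2 fun j hj => eventually_norm_lt_of_tendsto_ker
      (fun z hz => tendsto_norm_zero_of_isQuotientBy hJ hρ hπ hz) (norm_lt j hj)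
  obtain ⟨m, hm⟩ := eventually_norm_lt.exists
  have relations (j : ℕ) (hj : j ≤ k) : ‖((ρ m).comp f) (r j)‖ ≤ 1 / ((k : ℝ) + 1) := (hm j hj).le
  refine ⟨m, stageDesc ((ρ m).comp f) relations, stage_hom_ext fun y => ?_⟩
  calc p m (stageDesc ((ρ m).comp f) relations (stageHom r k y)) = ((p m).comp (ρ m)) (f y) := by
        rw [stageDesc_stageHom]; rfl
    _ = σ (stageMap r k (stageHom r k y)) := by rw [hp, hπf, stageMap_stageHom]

end Stage

section Presentation

variable {A : Type u} [NonUnitalCStarAlgebra A]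

/-- A presentation of `A` by selfadjoint contractions: `f` is surjective, and the countably many
relations `r j` form a dense subset of its kernel. -/
structure IsPresentation (f : UnivAlg.{u} →⋆ₙₐ[ℂ] A) (r : ℕ → UnivAlg.{u}) : Prop where
  surjective : Function.Surjective f
  map_eq_zero : ∀ j, f (r j) = 0
  mem_closure : ∀ z, f z = 0 → z ∈ closure (Set.range r)

lemma surjective_of_selfAdjoint_contractions_mem_range {B : Type*} [NonUnitalCStarAlgebra B]
    {f : B →⋆ₙₐ[ℂ] A} (h : ∀ a : A, IsSelfAdjoint a → ‖a‖ ≤ 1 → a ∈ Set.range f) :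
    Function.Surjective f := by
  have selfAdjoint_mem (a : A) (ha : IsSelfAdjoint a) : a ∈ Set.range f := by
    have hpos : 0 < ‖a‖ + 1 := by positivity
    obtain ⟨y, hy⟩ := h ((‖a‖ + 1)⁻¹ • a) ((IsSelfAdjoint.all _).smul ha) (by
      rw [norm_smul, norm_inv, Real.norm_of_nonneg hpos.le, inv_mul_le_one₀ hpos]
      linarith)
    refine ⟨((‖a‖ + 1 : ℝ) : ℂ) • y, ?_⟩
    rw [map_smul, hy, Complex.coe_smul, smul_inv_smul₀ hpos.ne']
  intro a
  obtain ⟨y, hy⟩ := selfAdjoint_mem _ (realPart a).2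
  obtain ⟨z, hz⟩ := selfAdjoint_mem _ (imaginaryPart a).2
  refine ⟨y + Complex.I • z, ?_⟩
  rw [map_add, map_smul, hy, hz, realPart_add_I_smul_imaginaryPart]

lemma exists_univAlg_surjection [TopologicalSpace.SeparableSpace A] :
    ∃ f : UnivAlg.{u} →⋆ₙₐ[ℂ] A, Function.Surjective f := by
  let U : Set A := {a | IsSelfAdjoint a ∧ ‖a‖ ≤ 1}
  have : Nonempty U := ⟨⟨0, IsSelfAdjoint.zero _, by simp⟩⟩
  let x : ℕ → U := TopologicalSpace.denseSeq U
  obtain ⟨f, hf⟩ := exists_univAlg_hom (x := fun n => (x n : A)) fun n => (x n).2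
  refine ⟨f, surjective_of_selfAdjoint_contractions_mem_range fun a ha hnorm => ?_⟩
  have range_subset : Set.range x ⊆ Subtype.val ⁻¹' Set.range f := by
    rintro _ ⟨n, rfl⟩
    exact ⟨univGen n, hf n⟩
  exact closure_minimal range_subset ((isClosed_range f).preimage continuous_subtype_val)
    (TopologicalSpace.denseRange_denseSeq U ⟨a, ha, hnorm⟩)

lemma exists_isPresentation (A : Type u) [NonUnitalCStarAlgebra A]
    [TopologicalSpace.SeparableSpace A] :
    ∃ (f : UnivAlg.{u} →⋆ₙₐ[ℂ] A) (r : ℕ → UnivAlg.{u}), IsPresentation f r := by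
  obtain ⟨f, hf⟩ := exists_univAlg_surjection (A := A)
  obtain ⟨s, hsub, hcount, hdense⟩ :=
    (TopologicalSpace.IsSeparable.of_separableSpace {z | f z = 0}).exists_countable_dense_subset
  have hne : s.Nonempty := closure_nonempty_iff.1 ⟨0, hdense (map_zero f)⟩
  obtain ⟨r, rfl⟩ := hcount.exists_eq_range hne
  exact ⟨f, r, hf, fun j => hsub ⟨j, rfl⟩, fun z hz => hdense hz⟩

namespace IsPresentation

variable {f : UnivAlg.{u} →⋆ₙₐ[ℂ] A} {r : ℕ → UnivAlg.{u}}

/-- The map from a stage to the algebra that is presented. -/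
noncomputable def toLimit (hr : IsPresentation f r) (k : ℕ) : Stage r k →⋆ₙₐ[ℂ] A :=
  stageDesc f fun j _ => by
    rw [hr.map_eq_zero, norm_zero]
    positivity

lemma toLimit_stageHom (hr : IsPresentation f r) (k : ℕ) (y : UnivAlg.{u}) :
    hr.toLimit k (stageHom r k y) = f y :=
  stageDesc_stageHom _ _ y

lemma tendsto_norm_stageHom_zero (hr : IsPresentation f r) {z : UnivAlg.{u}} (hz : f z = 0) :
    Tendsto (fun k => ‖stageHom r k z‖) atTop (𝓝 0) := by
  refine tendsto_norm_zero_of_mem_closure ?_ (hr.mem_closure z hz)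
  rintro _ ⟨j, rfl⟩
  refine squeeze_zero' (.of_forall fun _ => norm_nonneg _) ?_
    (tendsto_one_div_add_atTop_nhds_zero_nat (𝕜 := ℝ))
  filter_upwards [eventually_ge_atTop j] with k hk using norm_stageHom_le hk

lemma tendsto_norm_stageHom (hr : IsPresentation f r) (y : UnivAlg.{u}) :
    Tendsto (fun k => ‖stageHom r k y‖) atTop (𝓝 ‖f y‖) := by
  refine tendsto_order.2 ⟨fun a ha => .of_forall fun k => ha.trans_le ?_, fun a ha =>
    eventually_norm_lt_of_tendsto_ker (fun _ => hr.tendsto_norm_stageHom_zero) ha⟩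
  rw [← hr.toLimit_stageHom k]
  exact NonUnitalStarAlgHom.norm_apply_le _ _

theorem isShapeSystem_stageSystem (hr : IsPresentation f r) :
    (stageSystem r).IsShapeSystem A := by
  refine ⟨⟨hr.toLimit, fun k => stage_hom_ext fun y => ?_, fun a => ?_, fun k a => ?_⟩,
    semiprojectiveHom_stageMap r⟩
  · rw [NonUnitalStarAlgHom.comp_apply, stageMap_stageHom, hr.toLimit_stageHom,
      hr.toLimit_stageHom]
  · obtain ⟨y, rfl⟩ := hr.surjective a
    exact subset_closure (Set.mem_iUnion.2 ⟨0, stageHom r 0 y, hr.toLimit_stageHom 0 y⟩)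
  · obtain ⟨y, rfl⟩ := stageHom_surjective r k a
    rw [hr.toLimit_stageHom]
    refine ((hr.tendsto_norm_stageHom y).comp (tendsto_add_atTop_nat k)).congr fun n => ?_
    rw [stageSystem_trans, Function.comp_apply, add_comm]

lemma eventually_forall_norm_stageHom_path_lt (hr : IsPresentation f r)
    {ω : C(unitInterval, UnivAlg.{u})} {ε : ℝ} (hω : ∀ t, ‖f (ω t)‖ < ε) :
    ∀ᶠ l in atTop, ∀ t, ‖stageHom r l (ω t)‖ < ε := by
  have hrange := eventually_forall_norm_lt_of_tendsto_ker
    (fun _ => hr.tendsto_norm_stageHom_zero) (isCompact_range ω.continuous)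
    (Set.forall_mem_range.2 hω)
  exact hrange.mono fun l hl => Set.forall_mem_range.1 hl

theorem exists_homotopic_zero [TopologicalSpace.SeparableSpace A] (hr : IsPresentation f r)
    (hA : IsWeaklyProjective A) (k : ℕ) :
    ∃ (l : ℕ) (h : k ≤ l), Homotopic ((stageSystem r).trans h) 0 := by
  obtain ⟨σ, ψ, ψ_zero, ψ_one, hψ⟩ := hA.exists_path hr.surjective ((Set.finite_Iic k).image r)
    (Set.forall_mem_image.2 fun j _ => hr.map_eq_zero j) (Nat.one_div_pos_of_nat (n := k))
  have eventually_lt : ∀ᶠ l in atTop, ∀ j ∈ Set.Iic k,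
      ∀ t, ‖stageHom r l (ψ (r j) t)‖ < 1 / ((k : ℝ) + 1) :=
    (Set.finite_Iic k).eventually_all.2 fun j hj =>
      hr.eventually_forall_norm_stageHom_path_lt (hψ _ ⟨j, hj, rfl⟩)
  obtain ⟨l, hl, hkl⟩ := (eventually_lt.and (eventually_ge_atTop k)).exists
  let Ψ : Stage r k →⋆ₙₐ[ℂ] C(unitInterval, Stage r l) :=
    stageDesc ((mapPath (stageHom r l)).comp ψ) fun j hj =>
      (ContinuousMap.norm_le _ (by positivity)).2 fun t => (hl j hj t).le
  have Ψ_apply (y : UnivAlg.{u}) (t : unitInterval) :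
      Ψ (stageHom r k y) t = stageHom r l (ψ y t) :=
    DFunLike.congr_fun (stageDesc_stageHom ((mapPath (stageHom r l)).comp ψ) _ y) t
  have Ψ_zero : (evalHom _ 0).comp Ψ = (stageSystem r).trans hkl := stage_hom_ext fun y => by
    rw [stageSystem_trans, ← ψ_zero y, ← Ψ_apply, ψ_zero y]
    rfl
  have Ψ_one : (evalHom _ 1).comp Ψ = (stageHom r l).comp (σ.comp (hr.toLimit k)) :=
    stage_hom_ext fun y => by
      change Ψ (stageHom r k y) 1 = stageHom r l (σ (hr.toLimit k (stageHom r k y)))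
      rw [Ψ_apply, ψ_one, hr.toLimit_stageHom]
  have contract : Homotopic ((stageHom r l).comp (σ.comp (hr.toLimit k))) 0 :=
    (homotopic_of_univAlg (stageHom r l) 0).comp_right _
  exact ⟨l, hkl, (Ψ_zero ▸ Ψ_one ▸ homotopic_of_path Ψ).trans contract⟩

end IsPresentation

end Presentation

section TrivialShape

/-- The constant inductive system of the zero algebra. -/
noncomputable def zeroSystem : InductiveSystem.{u} where
  obj _ := PUnit.{u + 1}
  map _ := 0

instance (k : ℕ) : Subsingleton (zeroSystem.{u}.obj k) :=
  inferInstanceAs (Subsingleton PUnit.{u + 1})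

lemma isShapeSystem_zeroSystem : zeroSystem.{u}.IsShapeSystem PUnit.{u + 1} := by
  refine ⟨⟨fun _ => 0, fun _ => rfl, fun x => subset_closure (Set.mem_iUnion.2 ⟨0, 0, rfl⟩),
    fun k a => ?_⟩, fun k => ?_⟩
  · simp [Subsingleton.elim _ (0 : zeroSystem.{u}.obj _)]
  · intro C _ _ J _ _ D _ Q _ ρ π p _ _ _ σ
    refine ⟨0, 0, NonUnitalStarAlgHom.ext fun a => ?_⟩
    exact (map_zero (p 0)).trans (map_zero σ).symm

lemma InductiveSystem.equivalent_zeroSystem {S : InductiveSystem.{u}}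
    (hS : ∀ k, ∃ (l : ℕ) (h : k ≤ l), Homotopic (S.trans h) 0) : S.Equivalent zeroSystem := by
  choose l hl hnull using hS
  let k (i : ℕ) : ℕ := (fun m => l m + 2)^[i] 0
  have k_succ (i : ℕ) : k (i + 1) = l (k i) + 2 := Function.iterate_succ_apply' _ _ _
  have hkn (i : ℕ) : k i < l (k i) + 1 := Nat.lt_succ_of_le (hl _)
  have hnk (i : ℕ) : l (k i) + 1 < k (i + 1) := by rw [k_succ]; exact Nat.lt_succ_self _
  refine ⟨k, fun i => l (k i) + 1, hkn, hnk, fun _ => 0, fun _ => 0, fun i => ?_, fun i => ?_⟩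
  · exact (S.homotopic_trans_zero_of_le (hnull (k i)) (Nat.le_of_succ_le (hnk i).le)).symm
  · have heq : ∀ φ χ : zeroSystem.{u}.obj (l (k i) + 1) →⋆ₙₐ[ℂ]
        zeroSystem.{u}.obj (l (k (i + 1)) + 1), φ = χ :=
      fun _ _ => NonUnitalStarAlgHom.ext fun _ => Subsingleton.elim _ _
    rw [heq ((0 : S.obj (k (i + 1)) →⋆ₙₐ[ℂ] _).comp 0)]
    exact Homotopic.refl _

theorem IsWeaklyProjective.hasTrivialShape {A : Type u} [NonUnitalCStarAlgebra A]
    [TopologicalSpace.SeparableSpace A] (hA : IsWeaklyProjective A) : HasTrivialShape A := by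
  obtain ⟨f, r, hr⟩ := exists_isPresentation A
  exact ⟨stageSystem r, zeroSystem, hr.isShapeSystem_stageSystem, isShapeSystem_zeroSystem,
    InductiveSystem.equivalent_zeroSystem (hr.exists_homotopic_zero hA)⟩

end TrivialShape

end CStarShape

theorem mainTheorem2 (A : Type u) [NonUnitalCStarAlgebra A]
    [TopologicalSpace.SeparableSpace A] :
    (CStarShape.IsProjective A ↔
      CStarShape.IsSemiprojective A ∧ CStarShape.HasTrivialShape A) ∧
    (CStarShape.IsWeaklyProjective A ↔
      CStarShape.IsWeaklySemiprojective A ∧ CStarShape.HasTrivialShape A) := by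
  refine ⟨⟨fun hproj => ⟨?_, ?_⟩, fun ⟨hsemi, hshape⟩ => ?_⟩,
    ⟨fun hweak => ⟨?_, ?_⟩, fun ⟨hsemi, hshape⟩ => ?_⟩⟩
  · exact CStarShape.ProjectiveHom.semiprojectiveHom hproj
  · have hweak : CStarShape.IsWeaklyProjective A :=
      CStarShape.ProjectiveHom.weaklyProjectiveHom hproj
    exact hweak.hasTrivialShape
  · have hweakSemi : CStarShape.IsWeaklySemiprojective A :=
      CStarShape.SemiprojectiveHom.weaklySemiprojectiveHom hsemi
    exact (hweakSemi.isWeaklyProjective hshape).isProjective hsemi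
  · exact CStarShape.WeaklyProjectiveHom.weaklySemiprojectiveHom hweak
  · exact hweak.hasTrivialShape
  · exact hsemi.isWeaklyProjective hshape
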